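/- **Setting.** Program variables are classical or quantum, each with a non-empty set of values. A classical memory $m$ assigns a value to every classical variable; the quantum variables have the state space $\ell^2(\text{assignments of values to the quantum variables})$. Every variable $v$ has two copies $v_1,v_2$ (left and right memory); for a list $Q$ of variables, $Q_1,Q_2$ are its indexed copies, and for an expression $e$ in the classical variables, $e_1,e_2$ are its indexed versions. For a list $Q$ of distinct quantum variables, $\ell^2(Q)$ denotes the space $\ell^2(T_Q)$, where $T_Q$ is the product of the value sets of the variables in $Q$. A *cq-operator* is a positive trace-class operator of the form $\rho=\sum_m|m\rangle\langle m|\otimes\rho_m$; over the pair of memories it is *separable* if $\rho=\sum_i\sigma_i\otimes\tau_i$ for cq-operators $\sigma_i$, $\tau_i$ over the left and right memory. A *quantum predicate* $A$ over the indexed variables maps each classical memory $m$ (of indexed variables) to a closed subspace $A_m$ of the quantum state space; $\rho$ *satisfies* $A$ if $\operatorname{supp}\rho_m\subseteq A_m$ for all $m$. Intersections are taken pointwise. $\operatorname{fv}(B)$ is the set of classical and quantum variables on which $B$ depends: the intersection of all sets $S$ of indexed variables such that $B_m$ depends only on the classical variables in $S$ and is always of the form $B'\otimes\ell^2(\text{quantum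 variables outside }S)$. $\mathrm{Cl}[P]$ is the whole space where $P$ holds and $0$ elsewhere. For a list $X$ of distinct indexed quantum variables and $\psi\in\ell^2(X)$, $\operatorname{span}_X\psi$ is the predicate $\mathbb C\psi\otimes\ell^2(\text{variables outside }X)$. For disjoint lists $X,Y$ of distinct indexed quantum variables and bounded operators $A:\ell^2(X)\to\ell^2(Z)$, $A':\ell^2(Y)\to\ell^2(Z)$ (which may depend on the classical variables), the *quantum equality* $AX\equiv_{\mathrm{quant}}A'Y$ is the space of vectors fixed by the operator that acts on $XY$ as $x\otimes y\mapsto A^*A'y\otimes A'^*A\,x$ (and as the identity elsewhere). For lists with the same types, $X\equiv_{\mathrm{quant}}Y$ stands for $\mathrm{id}\,X\equiv_{\mathrm{quant}}\mathrm{id}\,Y$, i.e. invariance under swapping $X$ and $Y$. The program $\mathbf{Init}\ Q\ e$, where $e$ is an expression in the classical variables whose values are unit vectors in $\ell^2(Q)$, has the denotation $|m\rangle\langle m|\otimes\rho_m\mapsto|m\rangle\langle m|\otimes\operatorname{tr}_Q\rho_m\otimes|e(m)\rangle\langle e(m)|$. The judgment $\{A\}\,c\sim d\,\{B\}$ means: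 for every separable cq-operator $\rho$ over the pair of memories that satisfies $A$ there is a separable cq-operator $\rho'$ that satisfies $B$, such that $\operatorname{tr}_2\rho'=[\![c]\!](\operatorname{tr}_2\rho)$ and $\operatorname{tr}_1\rho'=[\![d]\!](\operatorname{tr}_1\rho)$, where $\operatorname{tr}_2$, $\operatorname{tr}_1$ trace out the right and the left memory. **Theorem.** Let $R,Q$ be disjoint finite lists of distinct quantum variables, and likewise $R',Q'$. Let $e,e'$ be expressions in the classical variables whose values are unit vectors in $\ell^2(Q)$ and $\ell^2(Q')$, respectively. Let $B$ be a quantum predicate over the indexed variables with $\operatorname{fv}(B)\cap Q_1Q'_2=\varnothing$. 1. (JointQInitEq) Let $V,V',U,U'$ be expressions in the classical variables of both memories whose values are bounded operators $V:\ell^2(R)\to\ell^2(W)$, $V':\ell^2(R')\to\ell^2(W)$, $U:\ell^2(Q)\to\ell^2(Z)$, $U':\ell^2(Q')\to\ell^2(Z)$, for some sets $W,Z$. Then $$\bigl\{B\cap\bigl((V\otimes U)R_1Q_1\equiv_{\mathrm{quant}}(V'\otimes U')R'_2Q'_2\bigr)\cap\mathrm{Cl}[U,U',V,V'\text{ are isometries}]\bigr\}$$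 $$\mathbf{Init}\ Q\ e\;\sim\;\mathbf{Init}\ Q'\ e'$$ $$\bigl\{B\cap(VR_1\equiv_{\mathrm{quant}}V'R'_2)\cap\operatorname{span}_{Q_1}e_1\cap\operatorname{span}_{Q'_2}e'_2\bigr\}.$$ 2. (JointQInitEq0) If the variables of $R$ and $R'$ have, in order, the same types, and so do those of $Q$ and $Q'$, then $$\{B\cap(R_1Q_1\equiv_{\mathrm{quant}}R'_2Q'_2)\}\ \ \mathbf{Init}\ Q\ e\;\sim\;\mathbf{Init}\ Q'\ e'\ \ \{B\cap(R_1\equiv_{\mathrm{quant}}R'_2)\}.$$ -/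

import Mathlib

open scoped InnerProductSpace

noncomputable section

/-! ## The spaces `ℓ²(X)` and operators on them -/

/-- The Hilbert space `ℓ²(X)`. -/
abbrev Ell2 (X : Type*) : Type _ := lp (fun _ : X => ℂ) 2

open Classical in
/-- The basis vector `|x⟩`. -/
def ket {X : Type*} (x : X) : Ell2 X := lp.single 2 x (1 : ℂ)

theorem memlp_two_iff {X : Type*} (f : X → ℂ) :
    Memℓp f 2 ↔ Summable fun x => ‖f x‖ ^ 2 := by
  rw [memℓp_gen_iff (by norm_num)]
  norm_num

theorem ell2_summable {X : Type*} (ψ : Ell2 X) : Summable fun x => ‖ψ x‖ ^ 2 :=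
  (memlp_two_iff _).1 (lp.memℓp ψ)

theorem ell2_norm_sq {X : Type*} (ψ : Ell2 X) : ‖ψ‖ ^ 2 = ∑' x, ‖ψ x‖ ^ 2 := by
  have h := lp.norm_rpow_eq_tsum (p := 2) (by norm_num) ψ
  simpa using h

/-- The unitary `ℓ²(X) → ℓ²(Y)`, `|x⟩ ↦ |e x⟩`, induced by a bijection `e`. -/
def reindex {X Y : Type*} (e : X ≃ Y) : Ell2 X ≃ₗᵢ[ℂ] Ell2 Y where
  toFun ψ := ⟨fun y => ψ (e.symm y), (memlp_two_iff _).2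
    ((e.symm.summable_iff (f := fun x => ‖ψ x‖ ^ 2)).2 (ell2_summable ψ))⟩
  invFun φ := ⟨fun x => φ (e x), (memlp_two_iff _).2
    ((e.summable_iff (f := fun y => ‖φ y‖ ^ 2)).2 (ell2_summable φ))⟩
  map_add' _ _ := rfl
  map_smul' _ _ := rfl
  left_inv ψ := by ext x; simp
  right_inv φ := by ext y; simp
  norm_map' ψ := by
    have h : ∀ χ : Ell2 Y, (∀ y, χ y = ψ (e.symm y)) → ‖χ‖ = ‖ψ‖ := by
      intro χ hχ
      have : ‖χ‖ ^ 2 = ‖ψ‖ ^ 2 := by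
        rw [ell2_norm_sq, ell2_norm_sq, ← e.symm.tsum_eq (fun x => ‖ψ x‖ ^ 2)]
        simp [hχ]
      exact (sq_eq_sq₀ (norm_nonneg _) (norm_nonneg _)).1 this
    exact h _ fun _ => rfl

@[simp] theorem reindex_apply {X Y : Type*} (e : X ≃ Y) (ψ : Ell2 X) (y : Y) :
    reindex e ψ y = ψ (e.symm y) := rfl

/-- Transport of an operator along a bijection of the index sets. -/
def conjBy {X Y : Type*} (e : X ≃ Y) (A : Ell2 Y →L[ℂ] Ell2 Y) : Ell2 X →L[ℂ] Ell2 X :=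
  ((reindex e).symm : Ell2 Y →L[ℂ] Ell2 X) ∘L A ∘L (reindex e : Ell2 X →L[ℂ] Ell2 Y)

@[simp] theorem conjBy_apply {X Y : Type*} (e : X ≃ Y) (A : Ell2 Y →L[ℂ] Ell2 Y) (ψ : Ell2 X)
    (x : X) : conjBy e A ψ x = A (reindex e ψ) (e x) := rfl

theorem slice_summable {X Y : Type*} (ψ : Ell2 (X × Y)) (y : Y) :
    Summable fun x => ‖ψ (x, y)‖ ^ 2 :=
  (ell2_summable ψ).comp_injective (i := fun x => (x, y)) fun _ _ h => (Prod.mk.inj h).1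

/-- The operator `id ⊗ ⟨y| : ℓ²(X × Y) → ℓ²(X)`. -/
def sliceSnd {X Y : Type*} (y : Y) : Ell2 (X × Y) →L[ℂ] Ell2 X :=
  LinearMap.mkContinuous
    { toFun := fun ψ => ⟨fun x => ψ (x, y), (memlp_two_iff _).2 (slice_summable ψ y)⟩
      map_add' := fun _ _ => rfl
      map_smul' := fun _ _ => rfl } 1 (by
    intro ψ
    rw [one_mul]
    refine (sq_le_sq₀ (norm_nonneg _) (norm_nonneg _)).1 ?_
    rw [ell2_norm_sq, ell2_norm_sq]
    exact tsum_comp_le_tsum_of_inj (ell2_summable ψ) (fun _ => by positivity)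
      (i := fun x => (x, y)) fun _ _ h => (Prod.mk.inj h).1)

@[simp] theorem sliceSnd_apply {X Y : Type*} (y : Y) (ψ : Ell2 (X × Y)) (x : X) :
    sliceSnd y ψ x = ψ (x, y) := rfl

/-- The operator `⟨x| ⊗ id : ℓ²(X × Y) → ℓ²(Y)`. -/
def sliceFst {X Y : Type*} (x : X) : Ell2 (X × Y) →L[ℂ] Ell2 Y :=
  sliceSnd x ∘L (reindex (Equiv.prodComm X Y) : Ell2 (X × Y) →L[ℂ] Ell2 (Y × X))

@[simp] theorem sliceFst_apply {X Y : Type*} (x : X) (ψ : Ell2 (X × Y)) (y : Y) :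
    sliceFst x ψ y = ψ (x, y) := rfl

theorem hasSum_sliceSnd_norm_sq {X Y : Type*} (ψ : Ell2 (X × Y)) :
    HasSum (fun y => ‖sliceSnd y ψ‖ ^ 2) (‖ψ‖ ^ 2) := by
  have hs : Summable fun p : Y × X => ‖ψ (p.2, p.1)‖ ^ 2 :=
    ((Equiv.prodComm Y X).summable_iff (f := fun p => ‖ψ p‖ ^ 2)).2 (ell2_summable ψ)
  have h2 := hs.hasSum.prod_fiberwise fun y => (slice_summable ψ y).hasSum
  have e1 : ∑' p : Y × X, ‖ψ (p.2, p.1)‖ ^ 2 = ‖ψ‖ ^ 2 := by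
    rw [ell2_norm_sq, ← (Equiv.prodComm Y X).tsum_eq (fun p => ‖ψ p‖ ^ 2)]
    rfl
  rw [e1] at h2
  convert h2 using 2 with y
  rw [ell2_norm_sq]
  rfl

theorem tensId_summable {X X' Y : Type*} (A : Ell2 X →L[ℂ] Ell2 X') (ψ : Ell2 (X × Y)) :
    Summable fun y => ‖A (sliceSnd y ψ)‖ ^ 2 := by
  refine Summable.of_nonneg_of_le (fun _ => by positivity) (fun y => ?_)
    ((hasSum_sliceSnd_norm_sq ψ).summable.mul_left (‖A‖ ^ 2))
  rw [← mul_pow]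
  exact pow_le_pow_left₀ (norm_nonneg _) (A.le_opNorm _) 2

theorem tensId_mem {X X' Y : Type*} (A : Ell2 X →L[ℂ] Ell2 X') (ψ : Ell2 (X × Y)) :
    Memℓp (fun p : X' × Y => A (sliceSnd p.2 ψ) p.1) 2 := by
  rw [memlp_two_iff, ← (Equiv.prodComm Y X').summable_iff]
  refine (summable_prod_of_nonneg fun _ => sq_nonneg _).2
    ⟨fun y => ell2_summable (A (sliceSnd y ψ)), ?_⟩
  have h := tensId_summable A ψ
  simp only [ell2_norm_sq] at h
  exact h

/-- The operator `A ⊗ id : ℓ²(X × Y) → ℓ²(X' × Y)`. -/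
def tensId {X X' : Type*} (A : Ell2 X →L[ℂ] Ell2 X') (Y : Type*) :
    Ell2 (X × Y) →L[ℂ] Ell2 (X' × Y) :=
  LinearMap.mkContinuous
    { toFun := fun ψ => ⟨fun p => A (sliceSnd p.2 ψ) p.1, tensId_mem A ψ⟩
      map_add' := fun ψ φ => by
        ext p
        simp only [map_add]
        rfl
      map_smul' := fun c ψ => by
        ext p
        simp only [map_smul]
        rfl } ‖A‖ (by
    intro ψ
    refine (sq_le_sq₀ (norm_nonneg _) (by positivity)).1 ?_
    rw [← (hasSum_sliceSnd_norm_sq _).tsum_eq, mul_pow, ← (hasSum_sliceSnd_norm_sq ψ).tsum_eq,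
      ← tsum_mul_left]
    refine Summable.tsum_le_tsum (fun y => ?_) (hasSum_sliceSnd_norm_sq _).summable
      ((hasSum_sliceSnd_norm_sq ψ).summable.mul_left _)
    rw [← mul_pow]
    exact pow_le_pow_left₀ (norm_nonneg _) (A.le_opNorm (sliceSnd y ψ)) 2)

@[simp] theorem tensId_apply {X X' Y : Type*} (A : Ell2 X →L[ℂ] Ell2 X') (ψ : Ell2 (X × Y))
    (p : X' × Y) : tensId A Y ψ p = A (sliceSnd p.2 ψ) p.1 := rfl

/-- The tensor product `A ⊗ B : ℓ²(X × Y) → ℓ²(X' × Y')` of two bounded operators, as the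
composition of `A ⊗ id` and `id ⊗ B`. -/
def tens {X X' Y Y' : Type*} (A : Ell2 X →L[ℂ] Ell2 X') (B : Ell2 Y →L[ℂ] Ell2 Y') :
    Ell2 (X × Y) →L[ℂ] Ell2 (X' × Y') :=
  tensId A Y' ∘L (reindex (Equiv.prodComm Y' X) : Ell2 (Y' × X) →L[ℂ] Ell2 (X × Y'))
    ∘L tensId B X ∘L (reindex (Equiv.prodComm X Y) : Ell2 (X × Y) →L[ℂ] Ell2 (Y × X))

/-- `proj ψ = ψψ*`. -/
def proj {X : Type*} (ψ : Ell2 X) : Ell2 X →L[ℂ] Ell2 X := InnerProductSpace.rankOne ℂ ψ ψ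

/-- Partial trace tracing out the first factor: `∑ₓ (⟨x| ⊗ id) ρ (|x⟩ ⊗ id)`. For positive
trace-class `ρ` the series converges (in trace norm, hence in operator norm). -/
def ptraceFst {X Y : Type*} (ρ : Ell2 (X × Y) →L[ℂ] Ell2 (X × Y)) : Ell2 Y →L[ℂ] Ell2 Y :=
  ∑' x : X, sliceFst x ∘L ρ ∘L (sliceFst x).adjoint

/-- Partial trace tracing out the second factor. -/
def ptraceSnd {X Y : Type*} (ρ : Ell2 (X × Y) →L[ℂ] Ell2 (X × Y)) : Ell2 X →L[ℂ] Ell2 X :=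
  ∑' y : Y, sliceSnd y ∘L ρ ∘L (sliceSnd y).adjoint

/-- The support of a self-adjoint operator: the closure of its range. -/
def supp {X : Type*} (A : Ell2 X →L[ℂ] Ell2 X) : ClosedSubmodule ℂ (Ell2 X) :=
  (LinearMap.range (A : Ell2 X →ₗ[ℂ] Ell2 X)).closure

/-- The `1`-eigenspace of a bounded operator. -/
def fixedSpace {X : Type*} (A : Ell2 X →L[ℂ] Ell2 X) : ClosedSubmodule ℂ (Ell2 X) where
  toSubmodule := LinearMap.ker ((A - ContinuousLinearMap.id ℂ (Ell2 X)) : Ell2 X →ₗ[ℂ] Ell2 X)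
  isClosed' := (A - ContinuousLinearMap.id ℂ (Ell2 X)).isClosed_ker

theorem mem_fixedSpace {X : Type*} (A : Ell2 X →L[ℂ] Ell2 X) (ψ : Ell2 X) :
    ψ ∈ fixedSpace A ↔ A ψ = ψ := by
  rw [← sub_eq_zero]
  rfl

/-- The closed subspace `S ⊗ ℓ²(Y)` of `ℓ²(M)`, where `M` is identified with `X × Y` by `e`. -/
def tensTop {M X Y : Type*} (e : M ≃ X × Y) (S : Submodule ℂ (Ell2 X)) :
    ClosedSubmodule ℂ (Ell2 M) :=
  (Submodule.span ℂ {ψ : Ell2 M | ∃ a ∈ S, ∃ φ : Ell2 Y,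
    ∀ m, ψ m = a (e m).1 * φ (e m).2}).closure

/-! ## Variables and memories

A set of variables is an index type `V` together with a type `T v` of values for each `v : V`.
Classical variables `CV` and quantum variables `QV` are kept in separate index types, so the set
of all program variables is `CV ⊕ QV`. A list of distinct variables is an embedding `ι ↪ V`. -/

/-- Assignments of values to variables. -/
abbrev Mem {V : Type*} (T : V → Type*) : Type _ := ∀ v, T v

/-- The two programs (memories) compared in a judgment. -/
inductive Side : Type
  | one
  | two

/-- Types of the indexed variables: `v₁ = (v, Side.one)` and `v₂ = (v, Side.two)` have the type
of `v`. -/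
abbrev Idx {V : Type*} (T : V → Type*) : V × Side → Type _ := fun p => T p.1

/-- The list of variables with every variable replaced by its `s`-indexed copy. -/
def at' {V ι : Type*} (Q : ι ↪ V) (s : Side) : ι ↪ V × Side :=
  ⟨fun i => (Q i, s), fun _ _ h => Q.injective (Prod.mk.inj h).1⟩

/-- Concatenation `R Q` of two disjoint lists of distinct variables. -/
def append {V κ ι : Type*} (R : κ ↪ V) (Q : ι ↪ V) (h : ∀ i j, R i ≠ Q j) : κ ⊕ ι ↪ V :=
  ⟨Sum.elim R Q, R.injective.sumElim Q.injective h⟩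

theorem at'_ne {V ι κ : Type*} (Q : ι ↪ V) (R : κ ↪ V) (i : ι) (j : κ) :
    at' Q Side.one i ≠ at' R Side.two j :=
  fun h => Side.noConfusion (Prod.mk.inj h).2

/-- The concatenation `Q₁ R₂` of a `1`-indexed and a `2`-indexed list. -/
def append12 {V ι κ : Type*} (Q : ι ↪ V) (R : κ ↪ V) : ι ⊕ κ ↪ V × Side :=
  append (at' Q Side.one) (at' R Side.two) (at'_ne Q R)

/-- Values of a list of variables (an indexed product). -/
abbrev Vals {V ι : Type*} (T : V → Type*) (Q : ι ↪ V) : Type _ := ∀ i, T (Q i)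

/-- The values of a concatenated list are pairs of values of the two lists. -/
def valsAppend {V κ ι : Type*} (T : V → Type*) (R : κ ↪ V) (Q : ι ↪ V) (h : ∀ i j, R i ≠ Q j) :
    Vals T (append R Q h) ≃ Vals T R × Vals T Q :=
  Equiv.sumPiEquivProdPi fun j => T (append R Q h j)

/-- The values of `Q₁ R₂` are pairs of values of `Q` and `R`. -/
def valsAppend12 {V ι κ : Type*} (T : V → Type*) (Q : ι ↪ V) (R : κ ↪ V) :
    Vals (Idx T) (append12 Q R) ≃ Vals T Q × Vals T R :=
  valsAppend (Idx T) (at' Q Side.one) (at' R Side.two) (at'_ne Q R)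

open Classical in
/-- A memory consists of the values of the variables in `Q` and the values of all others. -/
def splitMem {V ι : Type*} (T : V → Type*) (Q : ι ↪ V) :
    Mem T ≃ Vals T Q × (∀ v : {v // v ∉ Set.range Q}, T v) :=
  (Equiv.piEquivPiSubtypeProd (· ∈ Set.range Q) T).trans
    (Equiv.prodCongr
      (Equiv.piCongrLeft (fun v : Set.range Q => T v) (Equiv.ofInjective Q Q.injective)).symm
      (Equiv.refl _))

theorem splitMem_fst {V ι : Type*} (T : V → Type*) (Q : ι ↪ V) (m : Mem T) (i : ι) :
    (splitMem T Q m).1 i = m (Q i) := rfl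

theorem splitMem_snd {V ι : Type*} (T : V → Type*) (Q : ι ↪ V) (m : Mem T)
    (v : {v // v ∉ Set.range Q}) : (splitMem T Q m).2 v = m v := rfl

/-- The pair of memories encoded in a memory of indexed variables. -/
def pairMem {V : Type*} (T : V → Type*) : Mem (Idx T) ≃ Mem T × Mem T where
  toFun m := (fun v => m (v, Side.one), fun v => m (v, Side.two))
  invFun p := fun
    | (v, Side.one) => p.1 v
    | (v, Side.two) => p.2 v
  left_inv m := by
    funext ⟨v, s⟩
    cases s <;> rfl
  right_inv _ := rfl

/-- The operator `A` on `ℓ²(Vals Q)`, regarded as acting on the variables `Q` of the whole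
memory. -/
def liftOp {V ι : Type*} (T : V → Type*) (Q : ι ↪ V)
    (A : Ell2 (Vals T Q) →L[ℂ] Ell2 (Vals T Q)) : Ell2 (Mem T) →L[ℂ] Ell2 (Mem T) :=
  conjBy (splitMem T Q) (tensId A _)

/-! ## cq-operators -/

/-- A family `(ρ_m)` of operators, standing for `∑ₘ |m⟩⟨m| ⊗ ρ_m`, where `m` ranges over the
classical memories `M` and the `ρ_m` act on `ℓ²(X)`. -/
abbrev CQ (M X : Type*) : Type _ := M → (Ell2 X →L[ℂ] Ell2 X)

/-- `∑ₘ |m⟩⟨m| ⊗ ρ_m` is a cq-operator: all `ρ_m` are positive and the total trace is finite. -/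
def IsCQ {M X : Type*} (ρ : CQ M X) : Prop :=
  (∀ m, (ρ m).IsPositive) ∧
    Summable fun p : M × X => RCLike.re (⟪ket p.2, ρ p.1 (ket p.2)⟫_ℂ)

/-- cq-operators over one memory. -/
abbrev CQ1 {CV QV : Type*} (TC : CV → Type*) (TQ : QV → Type*) : Type _ := CQ (Mem TC) (Mem TQ)

/-- cq-operators over a pair of memories. -/
abbrev CQ2 {CV QV : Type*} (TC : CV → Type*) (TQ : QV → Type*) : Type _ :=
  CQ (Mem (Idx TC)) (Mem (Idx TQ))

section Judgments

variable {CV QV : Type*} {TC : CV → Type*} {TQ : QV → Type*}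

/-- Tracing out the right memory. -/
def tr2 (ρ : CQ2 TC TQ) : CQ1 TC TQ := fun m₁ =>
  ∑' m₂ : Mem TC, ptraceSnd (conjBy (pairMem TQ).symm (ρ ((pairMem TC).symm (m₁, m₂))))

/-- Tracing out the left memory. -/
def tr1 (ρ : CQ2 TC TQ) : CQ1 TC TQ := fun m₂ =>
  ∑' m₁ : Mem TC, ptraceFst (conjBy (pairMem TQ).symm (ρ ((pairMem TC).symm (m₁, m₂))))

/-- The cq-operator `ρ` over a pair of memories is separable: `ρ = ∑ᵢ σᵢ ⊗ τᵢ` for cq-operators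
`σᵢ`, `τᵢ` over the left and right memory. (For cq-operators the componentwise operator norm
convergence of a series of positive terms is equivalent to trace norm convergence.) -/
def Separable (ρ : CQ2 TC TQ) : Prop :=
  ∃ σ τ : ℕ → CQ1 TC TQ, (∀ i, IsCQ (σ i)) ∧ (∀ i, IsCQ (τ i)) ∧
    ∀ m : Mem (Idx TC), HasSum
      (fun i => conjBy (pairMem TQ) (tens (σ i (pairMem TC m).1) (τ i (pairMem TC m).2))) (ρ m)

/-! ## Quantum predicates -/

/-- Quantum predicates over the indexed variables: closed subspaces of the quantum states of the
two memories that depend on the classical part of the two memories. -/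
abbrev QPred (TC : CV → Type*) (TQ : QV → Type*) : Type _ :=
  Mem (Idx TC) → ClosedSubmodule ℂ (Ell2 (Mem (Idx TQ)))

/-- `ρ` satisfies `A`. -/
def Satisfies (ρ : CQ2 TC TQ) (A : QPred TC TQ) : Prop := ∀ m, supp (ρ m) ≤ A m

open Classical in
/-- `A` is a predicate over the variables in `S`: it depends only on the classical variables in
`S`, and its values are of the form `A' ⊗ ℓ²(quantum variables outside S)`. -/
def OverVars (A : QPred TC TQ) (S : Set ((CV × Side) ⊕ (QV × Side))) : Prop :=
  (∀ m m' : Mem (Idx TC), (∀ x, Sum.inl x ∈ S → m x = m' x) → A m = A m') ∧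
  ∀ m, ∃ A' : ClosedSubmodule ℂ (Ell2 (∀ q : {q : QV × Side // Sum.inr q ∈ S}, Idx TQ q)),
    A m = tensTop (Equiv.piEquivPiSubtypeProd (fun q => Sum.inr q ∈ S) (Idx TQ)) A'.toSubmodule

/-- The free variables of a quantum predicate: the intersection of all sets `S` of variables such
that `A` is a predicate over `S`. -/
def fv (A : QPred TC TQ) : Set ((CV × Side) ⊕ (QV × Side)) := ⋂₀ {S | OverVars A S}

/-- The set of variables in an `s`-indexed list of quantum variables. -/
def varsOf {ι : Type*} (Q : ι ↪ QV) (s : Side) : Set ((CV × Side) ⊕ (QV × Side)) :=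
  Set.range fun i => Sum.inr (at' Q s i)

open Classical in
/-- The quantum predicate that is everything where the classical predicate `P` holds, and `0`
elsewhere. -/
def Cl (P : Mem (Idx TC) → Prop) : QPred TC TQ := fun m => if P m then ⊤ else ⊥

/-- The quantum predicate saying that the `s`-indexed variables `Q` are in the state
`e` (where the expression `e` is evaluated on the classical variables with index `s`). -/
def spanAt {ι : Type*} (Q : ι ↪ QV) (s : Side) (e : Mem TC → Ell2 (Vals TQ Q)) : QPred TC TQ :=
  fun m => tensTop (splitMem (Idx TQ) (at' Q s)) (Submodule.span ℂ {e fun x => m (x, s)})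

/-- The quantum equality `U Q₁ ≡quant V R₂`: the vectors fixed by the operator
`x ⊗ y ↦ U* V y ⊗ V* U x` on the variables `Q₁ R₂`, i.e. by the swap of `Q₁` and `R₂` after
`V* U ⊗ U* V`. Here `U`, `V` are expressions in the classical variables of both memories. -/
def quantEq {ι κ Z : Type*} (Q : ι ↪ QV) (R : κ ↪ QV)
    (U : Mem (Idx TC) → Ell2 (Vals TQ Q) →L[ℂ] Ell2 Z)
    (V : Mem (Idx TC) → Ell2 (Vals TQ R) →L[ℂ] Ell2 Z) : QPred TC TQ := fun m =>
  fixedSpace <| liftOp (Idx TQ) (append12 Q R) <| conjBy (valsAppend12 TQ Q R) <|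
    (reindex (Equiv.prodComm (Vals TQ R) (Vals TQ Q)) :
      Ell2 (Vals TQ R × Vals TQ Q) →L[ℂ] Ell2 (Vals TQ Q × Vals TQ R)) ∘L
    tens ((V m).adjoint ∘L U m) ((U m).adjoint ∘L V m)

/-- `V ⊗ U` as an operator on the values of the concatenated list `R Q`. -/
def tensAppend {κ ι W Z : Type*} (R : κ ↪ QV) (Q : ι ↪ QV) (h : ∀ i j, R i ≠ Q j)
    (V : Ell2 (Vals TQ R) →L[ℂ] Ell2 W) (U : Ell2 (Vals TQ Q) →L[ℂ] Ell2 Z) :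
    Ell2 (Vals TQ (append R Q h)) →L[ℂ] Ell2 (W × Z) :=
  tens V U ∘L (reindex (valsAppend TQ R Q h) :
    Ell2 (Vals TQ (append R Q h)) →L[ℂ] Ell2 (Vals TQ R × Vals TQ Q))

/-- The quantum equality `Q₁ ≡quant R₂` (that is, `id Q₁ ≡quant id R₂`: the vectors invariant
under swapping `Q₁` and `R₂`) for lists `Q`, `R` whose variables have, in order, the same types. -/
def quantEqId {ι : Type*} (Q R : ι ↪ QV) (h : ∀ i, TQ (Q i) = TQ (R i)) : QPred TC TQ :=
  quantEq Q R
    (fun _ => (reindex (Equiv.piCongrRight fun i => Equiv.cast (h i)) :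
      Ell2 (Vals TQ Q) →L[ℂ] Ell2 (Vals TQ R)))
    (fun _ => ContinuousLinearMap.id ℂ (Ell2 (Vals TQ R)))

/-- If two pairs of lists have the same types, so have the concatenations. -/
theorem append_types {κ ι : Type*} {R R' : κ ↪ QV} {Q Q' : ι ↪ QV}
    (hR : ∀ i, TQ (R i) = TQ (R' i)) (hQ : ∀ i, TQ (Q i) = TQ (Q' i))
    (h : ∀ i j, R i ≠ Q j) (h' : ∀ i j, R' i ≠ Q' j) :
    ∀ j, TQ (append R Q h j) = TQ (append R' Q' h' j)
  | Sum.inl i => hR i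
  | Sum.inr i => hQ i

/-! ## Initialization and judgments -/

/-- The denotation of the program `Init Q e`: the component `ρ_m` is mapped to
`tr_Q ρ_m ⊗ proj (e m)`. -/
def initDenot {ι : Type*} (Q : ι ↪ QV) (e : Mem TC → Ell2 (Vals TQ Q)) (ρ : CQ1 TC TQ) :
    CQ1 TC TQ := fun m =>
  conjBy (splitMem TQ Q)
    (tens (proj (e m)) (ptraceFst (conjBy (splitMem TQ Q).symm (ρ m))))

/-- The judgment `{A} c ~ d {B}`, for programs given by their denotations `c`, `d`. -/
def Rhl (A : QPred TC TQ) (c d : CQ1 TC TQ → CQ1 TC TQ) (B : QPred TC TQ) : Prop :=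
  ∀ ρ : CQ2 TC TQ, IsCQ ρ → Separable ρ → Satisfies ρ A →
    ∃ ρ' : CQ2 TC TQ, IsCQ ρ' ∧ Separable ρ' ∧ Satisfies ρ' B ∧
      tr2 ρ' = c (tr2 ρ) ∧ tr1 ρ' = d (tr1 ρ)

end Judgments

end

noncomputable section

/-! ## Vectors and operators on `ℓ²` -/

/-! Everything reduces to pure product states. A separable cq-operator is a mixture of states `ψ ⊗
φ` at classical memories `(m₁, m₂)` (`Separable.exists_isMix`), and if the mixture satisfies a
predicate, so does each of its vectors (`IsMix.mem_of_satisfies`). Conversely, a summable family of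
product vectors satisfying the postcondition yields an admissible coupling (`IsMix.isCQ`,
`IsMix.separable`, `IsMix.satisfies`), with explicit marginals (`IsMix.tr1`, `IsMix.tr2`).

Let `A = V ⊗ U` and `A' = V' ⊗ U'` be isometries, and let a nonzero `ψ ⊗ φ` lie in the quantum
equality. Since the state is a product, the fixed-point equation says `a ⊗ b = A*A'b ⊗ A'*A a` for
all slices `a`, `b` of `ψ`, `φ` along the two lists. This forces `ψ = u ⊗ G` and `φ = u' ⊗ G'` with
`A u = A' u'` (`exists_product_of_tvec_eq`): the compared variables are not entangled with the rest,
and their states agree up to the isometries.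

Now initialize by measuring: for an isometry `U`, the operators `|e⟩⟨z|U`, with `z` in the basis of
the common target space, are Kraus operators of the initialization (`hasSum_initOp_proj`). Applying
`id ⊗ ⟨z|` to `A u = A' u'` shows that the states left on `R` and `R'` after outcome `z` are still
identified by `V`, `V'`, and that both sides obtain `z` with the same relative weight
(`swapState_quantEq`). The coupling pairs equal outcomes, with weights chosen so that both marginals
are right (`exists_init_coupling`).

The predicate `B` survives because the Kraus operators act only on variables not in `fv B`
(`liftOp_mem_of_disjoint_fv`). The second claim is the first one for relabelling unitaries and
identities. -/

theorem ell2_hasSum_inner {X : Type*} (ψ φ : Ell2 X) :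
    HasSum (fun x => starRingEnd ℂ (ψ x) * φ x) ⟪ψ, φ⟫_ℂ := by
  have e : (fun x => starRingEnd ℂ (ψ x) * φ x) = fun x => ⟪ψ x, φ x⟫_ℂ :=
    funext fun x => mul_comm _ _
  rw [e]
  exact lp.hasSum_inner ψ φ

theorem inner_ket_left {X : Type*} (x : X) (ψ : Ell2 X) : ⟪ket x, ψ⟫_ℂ = ψ x := by
  simp [ket, lp.inner_single_left]

theorem inner_ket_right {X : Type*} (x : X) (ψ : Ell2 X) :
    ⟪ψ, ket x⟫_ℂ = starRingEnd ℂ (ψ x) := by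
  rw [← inner_conj_symm, inner_ket_left]

open Classical in
theorem ket_apply {X : Type*} (x y : X) : ket x y = if y = x then 1 else 0 := by
  simp [ket, lp.single_apply, Pi.single_apply]

theorem hasSum_ket {X : Type*} (ψ : Ell2 X) : HasSum (fun x => ψ x • ket x) ψ := by
  classical
  convert lp.hasSum_single (p := 2) (by norm_num) ψ using 2 with x
  rw [ket, ← lp.single_smul]
  simp

theorem clm_ext_ket {X E : Type*} [NormedAddCommGroup E] [NormedSpace ℂ E]
    {A B : Ell2 X →L[ℂ] E} (h : ∀ x, A (ket x) = B (ket x)) : A = B := by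
  ext1 ψ
  have hA := (hasSum_ket ψ).mapL A
  have hB := (hasSum_ket ψ).mapL B
  simp only [map_smul, h] at hA hB
  exact hA.unique hB

theorem hasSum_ell2_norm_sq {X : Type*} (ψ : Ell2 X) : HasSum (fun x => ‖ψ x‖ ^ 2) (‖ψ‖ ^ 2) := by
  rw [ell2_norm_sq]
  exact (ell2_summable ψ).hasSum

theorem reindex_symm_apply {X Y : Type*} (e : X ≃ Y) (ψ : Ell2 Y) (x : X) :
    (reindex e).symm ψ x = ψ (e x) := rfl

/-- The product vector `ψ ⊗ φ`. -/
def tvec {X Y : Type*} (ψ : Ell2 X) (φ : Ell2 Y) : Ell2 (X × Y) :=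
  ⟨fun p => ψ p.1 * φ p.2, (memlp_two_iff _).2 (by
    simp only [norm_mul, mul_pow]
    exact (ell2_summable ψ).mul_of_nonneg (ell2_summable φ) (fun _ => sq_nonneg _)
      (fun _ => sq_nonneg _))⟩

@[simp] theorem tvec_apply {X Y : Type*} (ψ : Ell2 X) (φ : Ell2 Y) (p : X × Y) :
    tvec ψ φ p = ψ p.1 * φ p.2 := rfl

@[simp] theorem sliceSnd_tvec {X Y : Type*} (ψ : Ell2 X) (φ : Ell2 Y) (y : Y) :
    sliceSnd y (tvec ψ φ) = φ y • ψ := by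
  ext x
  simp [mul_comm]

@[simp] theorem sliceFst_tvec {X Y : Type*} (ψ : Ell2 X) (φ : Ell2 Y) (x : X) :
    sliceFst x (tvec ψ φ) = ψ x • φ := by
  ext y
  simp

theorem norm_tvec {X Y : Type*} (ψ : Ell2 X) (φ : Ell2 Y) : ‖tvec ψ φ‖ = ‖ψ‖ * ‖φ‖ := by
  refine (sq_eq_sq₀ (norm_nonneg _) (by positivity)).1 ?_
  refine (hasSum_sliceSnd_norm_sq (tvec ψ φ)).unique ?_
  simp only [sliceSnd_tvec, norm_smul, mul_pow]
  rw [mul_comm]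
  exact (hasSum_ell2_norm_sq φ).mul_right _

theorem hasSum_sliceFst_norm_sq {X Y : Type*} (ψ : Ell2 (X × Y)) :
    HasSum (fun x => ‖sliceFst x ψ‖ ^ 2) (‖ψ‖ ^ 2) := by
  have := hasSum_sliceSnd_norm_sq (reindex (Equiv.prodComm X Y) ψ)
  rwa [LinearIsometryEquiv.norm_map] at this

theorem hasSum_inner_sliceSnd {X Y : Type*} (ψ φ : Ell2 (X × Y)) :
    HasSum (fun y => ⟪sliceSnd y ψ, sliceSnd y φ⟫_ℂ) ⟪ψ, φ⟫_ℂ := by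
  have h := ((Equiv.prodComm Y X).hasSum_iff).2 (ell2_hasSum_inner ψ φ)
  exact h.prod_fiberwise fun y => ell2_hasSum_inner (sliceSnd y ψ) (sliceSnd y φ)

theorem hasSum_inner_sliceFst {X Y : Type*} (ψ φ : Ell2 (X × Y)) :
    HasSum (fun x => ⟪sliceFst x ψ, sliceFst x φ⟫_ℂ) ⟪ψ, φ⟫_ℂ :=
  (ell2_hasSum_inner ψ φ).prod_fiberwise
    fun x => ell2_hasSum_inner (sliceFst x ψ) (sliceFst x φ)

theorem inner_tvec_left {X Y : Type*} (ψ : Ell2 X) (φ : Ell2 Y) (a : Ell2 X) (b : Ell2 Y) :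
    ⟪tvec ψ φ, tvec a b⟫_ℂ = ⟪ψ, a⟫_ℂ * ⟪φ, b⟫_ℂ := by
  refine (hasSum_inner_sliceSnd _ _).unique ?_
  simp only [sliceSnd_tvec, inner_smul_left, inner_smul_right]
  have h : (fun y => b y * (starRingEnd ℂ (φ y) * ⟪ψ, a⟫_ℂ))
      = fun y => ⟪ψ, a⟫_ℂ * (starRingEnd ℂ (φ y) * b y) := funext fun y => by ring
  rw [h]
  exact (ell2_hasSum_inner φ b).mul_left ⟪ψ, a⟫_ℂ

theorem ket_prod {X Y : Type*} (p : X × Y) : ket p = tvec (ket p.1) (ket p.2) := by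
  classical
  ext q
  simp only [ket_apply, tvec_apply, Prod.ext_iff]
  split_ifs <;> simp_all

@[simp] theorem sliceSnd_tensId {X X' Y : Type*} (A : Ell2 X →L[ℂ] Ell2 X') (ψ : Ell2 (X × Y))
    (y : Y) : sliceSnd y (tensId A Y ψ) = A (sliceSnd y ψ) := rfl

theorem sliceSnd_tens {X X' Y Y' : Type*} (A : Ell2 X →L[ℂ] Ell2 X') (B : Ell2 Y →L[ℂ] Ell2 Y')
    (ψ : Ell2 (X × Y)) (y : Y') :
    sliceSnd y (tens A B ψ) =
      A (sliceFst y (tensId B X (reindex (Equiv.prodComm X Y) ψ))) := rfl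

theorem tens_tvec {X X' Y Y' : Type*} (A : Ell2 X →L[ℂ] Ell2 X') (B : Ell2 Y →L[ℂ] Ell2 Y')
    (ψ : Ell2 X) (φ : Ell2 Y) : tens A B (tvec ψ φ) = tvec (A ψ) (B φ) := by
  have h : ∀ y, sliceFst y (tensId B X (reindex (Equiv.prodComm X Y) (tvec ψ φ)))
      = B φ y • ψ := by
    intro y
    ext x
    have : sliceSnd x (reindex (Equiv.prodComm X Y) (tvec ψ φ)) = ψ x • φ := by
      ext y; simp
    simp [this, mul_comm]
  ext ⟨x, y⟩
  have := congrArg (fun χ : Ell2 X' => χ x) (sliceSnd_tens A B (tvec ψ φ) y)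
  simp only [sliceSnd_apply, h] at this
  simp [this, mul_comm]

theorem norm_tensId_apply {X X' Y : Type*} {A : Ell2 X →L[ℂ] Ell2 X'} (hA : ∀ ψ, ‖A ψ‖ = ‖ψ‖)
    (ψ : Ell2 (X × Y)) : ‖tensId A Y ψ‖ = ‖ψ‖ := by
  refine (sq_eq_sq₀ (norm_nonneg _) (norm_nonneg _)).1 ?_
  refine (hasSum_sliceSnd_norm_sq _).unique ?_
  simp only [sliceSnd_tensId, hA]
  exact hasSum_sliceSnd_norm_sq ψ

theorem norm_tens_apply {X X' Y Y' : Type*} {A : Ell2 X →L[ℂ] Ell2 X'}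
    {B : Ell2 Y →L[ℂ] Ell2 Y'} (hA : ∀ ψ, ‖A ψ‖ = ‖ψ‖) (hB : ∀ ψ, ‖B ψ‖ = ‖ψ‖)
    (ψ : Ell2 (X × Y)) : ‖tens A B ψ‖ = ‖ψ‖ := by
  change ‖tensId A Y' (reindex _ (tensId B X (reindex _ ψ)))‖ = _
  rw [norm_tensId_apply hA, LinearIsometryEquiv.norm_map, norm_tensId_apply hB,
    LinearIsometryEquiv.norm_map]

/-! ### Rank-one operators -/

@[simp] theorem proj_zero {X : Type*} : proj (0 : Ell2 X) = 0 := by simp [proj]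

theorem proj_apply {X : Type*} (ψ φ : Ell2 X) : proj ψ φ = ⟪ψ, φ⟫_ℂ • ψ := rfl

theorem norm_proj {X : Type*} (ψ : Ell2 X) : ‖proj ψ‖ = ‖ψ‖ ^ 2 := by
  rw [proj, InnerProductSpace.norm_rankOne, sq]

theorem proj_smul {X : Type*} (c : ℂ) (ψ : Ell2 X) : proj (c • ψ) = ((‖c‖ ^ 2 : ℝ) : ℂ) • proj ψ := by
  ext1 φ
  simp only [proj_apply, inner_smul_left, smul_apply, smul_smul]
  congr 1
  have := RCLike.conj_mul c
  push_cast
  linear_combination ⟪ψ, φ⟫_ℂ * this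

theorem comp_proj_comp_adjoint {X Y : Type*} (A : Ell2 X →L[ℂ] Ell2 Y) (ψ : Ell2 X) :
    A ∘L proj ψ ∘L A.adjoint = proj (A ψ) := by
  ext1 φ
  simp [proj_apply, ContinuousLinearMap.adjoint_inner_right]

theorem conjBy_proj {X Y : Type*} (e : X ≃ Y) (ψ : Ell2 Y) :
    conjBy e (proj ψ) = proj ((reindex e).symm ψ) := by
  ext1 φ
  simp only [conjBy, ContinuousLinearMap.comp_apply, proj_apply, map_smul]
  congr 1
  exact LinearIsometryEquiv.inner_map_eq_flip (reindex e).symm ψ φ ▸ rfl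

theorem tens_proj {X Y : Type*} (ψ : Ell2 X) (φ : Ell2 Y) :
    tens (proj ψ) (proj φ) = proj (tvec ψ φ) := by
  refine clm_ext_ket fun p => ?_
  rw [ket_prod, tens_tvec, proj_apply, proj_apply, proj_apply, inner_tvec_left]
  ext q
  simp only [tvec_apply, lp.coeFn_smul, Pi.smul_apply, smul_eq_mul]
  ring

theorem inner_proj {X : Type*} (ψ a b : Ell2 X) : ⟪a, proj ψ b⟫_ℂ = ⟪a, ψ⟫_ℂ * ⟪ψ, b⟫_ℂ := by
  rw [proj_apply, inner_smul_right, mul_comm]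

theorem clm_ext_inner_ket {X : Type*} {A B : Ell2 X →L[ℂ] Ell2 X}
    (h : ∀ x y, ⟪ket x, A (ket y)⟫_ℂ = ⟪ket x, B (ket y)⟫_ℂ) : A = B := by
  refine clm_ext_ket fun y => ?_
  ext x
  simpa [inner_ket_left] using h x y

/-! ### Sums of operators -/

theorem HasSum.comp_clm_comp {ι E F G H : Type*} [NormedAddCommGroup E] [NormedSpace ℂ E]
    [NormedAddCommGroup F] [NormedSpace ℂ F] [NormedAddCommGroup G] [NormedSpace ℂ G]
    [NormedAddCommGroup H] [NormedSpace ℂ H] {f : ι → F →L[ℂ] G} {a : F →L[ℂ] G}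
    (h : HasSum f a) (A : G →L[ℂ] H) (B : E →L[ℂ] F) :
    HasSum (fun i => A ∘L f i ∘L B) (A ∘L a ∘L B) :=
  h.mapL (((ContinuousLinearMap.compL ℂ E G H) A) ∘L ((ContinuousLinearMap.compL ℂ E F G).flip B))

theorem HasSum.conjBy {ι X Y : Type*} (e : X ≃ Y) {f : ι → Ell2 Y →L[ℂ] Ell2 Y}
    {a : Ell2 Y →L[ℂ] Ell2 Y} (h : HasSum f a) :
    HasSum (fun i => _root_.conjBy e (f i)) (_root_.conjBy e a) :=
  h.comp_clm_comp _ _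

/-- `A ↦ A ⊗ id` as a bounded linear map. -/
def tensIdL (X X' Y : Type*) :
    (Ell2 X →L[ℂ] Ell2 X') →L[ℂ] (Ell2 (X × Y) →L[ℂ] Ell2 (X' × Y)) :=
  LinearMap.mkContinuous
    { toFun := fun A => tensId A Y
      map_add' := fun _ _ => rfl
      map_smul' := fun _ _ => rfl } 1 fun A => by
    rw [one_mul]
    change ‖tensId A Y‖ ≤ ‖A‖
    rw [tensId]
    exact LinearMap.mkContinuous_norm_le _ (norm_nonneg A) _

theorem HasSum.tens_left {ι X X' Y Y' : Type*} {f : ι → Ell2 X →L[ℂ] Ell2 X'}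
    {A : Ell2 X →L[ℂ] Ell2 X'} (h : HasSum f A) (B : Ell2 Y →L[ℂ] Ell2 Y') :
    HasSum (fun i => tens (f i) B) (tens A B) :=
  HasSum.mapL ((ContinuousLinearMap.compL ℂ (Ell2 (X × Y)) (Ell2 (X × Y')) (Ell2 (X' × Y'))).flip
    ((reindex (Equiv.prodComm Y' X) : Ell2 (Y' × X) →L[ℂ] Ell2 (X × Y'))
    ∘L tensId B X ∘L (reindex (Equiv.prodComm X Y) : Ell2 (X × Y) →L[ℂ] Ell2 (Y × X))))
    (h.mapL (tensIdL X X' Y'))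

theorem HasSum.tens_right {ι X X' Y Y' : Type*} (A : Ell2 X →L[ℂ] Ell2 X')
    {f : ι → Ell2 Y →L[ℂ] Ell2 Y'} {B : Ell2 Y →L[ℂ] Ell2 Y'} (h : HasSum f B) :
    HasSum (fun i => tens A (f i)) (tens A B) :=
  HasSum.comp_clm_comp (h.mapL (tensIdL Y Y' X))
    (tensId A Y' ∘L (reindex (Equiv.prodComm Y' X) : Ell2 (Y' × X) →L[ℂ] Ell2 (X × Y')))
    (reindex (Equiv.prodComm X Y) : Ell2 (X × Y) →L[ℂ] Ell2 (Y × X))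

/-- Fubini for series. Partial traces are themselves infinite sums and are not continuous in
operator norm, so exchanging them with a mixture needs absolute summability of the double family. -/
theorem hasSum_tsum_tsum {ι κ E : Type*} [NormedAddCommGroup E] [CompleteSpace E]
    {f : ι → κ → E} (hf : Summable fun p : ι × κ => ‖f p.1 p.2‖) {g : ι → E}
    (hg : ∀ i, HasSum (f i) (g i)) : HasSum g (∑' k, ∑' i, f i k) := by
  have h : Summable fun p : ι × κ => f p.1 p.2 := hf.of_norm
  have h' : Summable fun p : κ × ι => f p.2 p.1 := (Equiv.prodComm κ ι).summable_iff.2 h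
  have e : ∑' p : ι × κ, f p.1 p.2 = ∑' k, ∑' i, f i k := by
    rw [← (Equiv.prodComm κ ι).tsum_eq]
    exact h'.tsum_prod
  rw [← e]
  exact h.hasSum.prod_fiberwise hg

theorem summable_proj {ι X : Type*} {χ : ι → Ell2 X} (h : Summable fun i => ‖χ i‖ ^ 2) :
    Summable fun i => ‖proj (χ i)‖ := by
  simpa only [norm_proj] using h

theorem summable_prod_of_hasSum {ι κ : Type*} {g : ι → κ → ℝ} (hg0 : ∀ i k, 0 ≤ g i k)
    {s : ι → ℝ} (hg : ∀ i, HasSum (g i) (s i)) (hs : Summable s) :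
    Summable fun p : ι × κ => g p.1 p.2 := by
  refine (summable_prod_of_nonneg fun _ => hg0 _ _).2 ⟨fun i => (hg i).summable, ?_⟩
  simpa only [(hg _).tsum_eq] using hs

/-! ### Partial traces of pure states and of their mixtures. -/

theorem summable_proj_sliceFst {X Y : Type*} (χ : Ell2 (X × Y)) :
    Summable fun x => proj (sliceFst x χ) :=
  (summable_proj (hasSum_sliceFst_norm_sq χ).summable).of_norm

theorem summable_proj_sliceSnd {X Y : Type*} (χ : Ell2 (X × Y)) :
    Summable fun y => proj (sliceSnd y χ) :=
  (summable_proj (hasSum_sliceSnd_norm_sq χ).summable).of_norm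

theorem hasSum_ptraceFst_proj {X Y : Type*} (χ : Ell2 (X × Y)) :
    HasSum (fun x => proj (sliceFst x χ)) (ptraceFst (proj χ)) := by
  simp only [ptraceFst, comp_proj_comp_adjoint]
  exact (summable_proj_sliceFst χ).hasSum

theorem hasSum_ptraceSnd_proj {X Y : Type*} (χ : Ell2 (X × Y)) :
    HasSum (fun y => proj (sliceSnd y χ)) (ptraceSnd (proj χ)) := by
  simp only [ptraceSnd, comp_proj_comp_adjoint]
  exact (summable_proj_sliceSnd χ).hasSum

theorem hasSum_ptraceFst {ι X Y : Type*} {χ : ι → Ell2 (X × Y)}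
    (h : Summable fun i => ‖χ i‖ ^ 2) {ρ : Ell2 (X × Y) →L[ℂ] Ell2 (X × Y)}
    (hρ : HasSum (fun i => proj (χ i)) ρ) :
    HasSum (fun i => ptraceFst (proj (χ i))) (ptraceFst ρ) := by
  have e : ptraceFst ρ = ∑' x, ∑' i, proj (sliceFst x (χ i)) := by
    refine tsum_congr fun x => ?_
    rw [← (hρ.comp_clm_comp (sliceFst x) (sliceFst x).adjoint).tsum_eq]
    simp only [comp_proj_comp_adjoint]
  rw [e]
  refine hasSum_tsum_tsum (f := fun i x => proj (sliceFst x (χ i))) ?_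
    fun i => hasSum_ptraceFst_proj (χ i)
  simp only [norm_proj]
  exact summable_prod_of_hasSum (g := fun i x => ‖sliceFst x (χ i)‖ ^ 2)
    (fun _ _ => sq_nonneg _) (fun i => hasSum_sliceFst_norm_sq (χ i)) h

theorem hasSum_ptraceSnd {ι X Y : Type*} {χ : ι → Ell2 (X × Y)}
    (h : Summable fun i => ‖χ i‖ ^ 2) {ρ : Ell2 (X × Y) →L[ℂ] Ell2 (X × Y)}
    (hρ : HasSum (fun i => proj (χ i)) ρ) :
    HasSum (fun i => ptraceSnd (proj (χ i))) (ptraceSnd ρ) := by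
  have e : ptraceSnd ρ = ∑' x, ∑' i, proj (sliceSnd x (χ i)) := by
    refine tsum_congr fun x => ?_
    rw [← (hρ.comp_clm_comp (sliceSnd x) (sliceSnd x).adjoint).tsum_eq]
    simp only [comp_proj_comp_adjoint]
  rw [e]
  refine hasSum_tsum_tsum (f := fun i x => proj (sliceSnd x (χ i))) ?_
    fun i => hasSum_ptraceSnd_proj (χ i)
  simp only [norm_proj]
  exact summable_prod_of_hasSum (g := fun i x => ‖sliceSnd x (χ i)‖ ^ 2)
    (fun _ _ => sq_nonneg _) (fun i => hasSum_sliceSnd_norm_sq (χ i)) h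

theorem hasSum_proj_smul {X Y : Type*} (ψ : Ell2 X) (φ : Ell2 Y) :
    HasSum (fun y => proj (φ y • ψ)) (proj ((‖φ‖ : ℂ) • ψ)) := by
  simp only [proj_smul, Complex.norm_real, norm_norm]
  refine HasSum.smul_const ?_ _
  exact Complex.hasSum_ofReal.2 (hasSum_ell2_norm_sq φ)

theorem ptraceSnd_proj_tvec {X Y : Type*} (ψ : Ell2 X) (φ : Ell2 Y) :
    ptraceSnd (proj (tvec ψ φ)) = proj ((‖φ‖ : ℂ) • ψ) := by
  refine (hasSum_ptraceSnd_proj _).unique ?_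
  simpa only [sliceSnd_tvec] using hasSum_proj_smul ψ φ

theorem ptraceFst_proj_tvec {X Y : Type*} (ψ : Ell2 X) (φ : Ell2 Y) :
    ptraceFst (proj (tvec ψ φ)) = proj ((‖ψ‖ : ℂ) • φ) := by
  refine (hasSum_ptraceFst_proj _).unique ?_
  simpa only [sliceFst_tvec] using hasSum_proj_smul φ ψ

theorem HasSum.inner_ket {ι Y : Type*} {f : ι → Ell2 Y →L[ℂ] Ell2 Y} {A : Ell2 Y →L[ℂ] Ell2 Y}
    (h : HasSum f A) (y y' : Y) :
    HasSum (fun i => ⟪ket y, f i (ket y')⟫_ℂ) ⟪ket y, A (ket y')⟫_ℂ :=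
  h.mapL (innerSL ℂ (ket y) ∘L ContinuousLinearMap.apply ℂ (Ell2 Y) (ket y'))

/-- The matrix entries of a partial trace are inner products of slices living in the traced-out
register, and inner products do not see an isometry applied there. -/
theorem hasSum_inner_ket_proj_sliceFst {X Y : Type*} (ξ : Ell2 (X × Y)) (y y' : Y) :
    HasSum (fun x => ⟪ket y, proj (sliceFst x ξ) (ket y')⟫_ℂ)
      ⟪sliceSnd y' ξ, sliceSnd y ξ⟫_ℂ := by
  simp only [inner_proj, inner_ket_left, inner_ket_right]
  convert ell2_hasSum_inner (sliceSnd y' ξ) (sliceSnd y ξ) using 2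
  exact mul_comm _ _

/-- Tracing out a register does not depend on isometries applied to it. -/
theorem hasSum_proj_sliceFst_tensId {X Y Z : Type*} {U : Ell2 X →L[ℂ] Ell2 Z}
    (hU : ∀ ψ, ‖U ψ‖ = ‖ψ‖) (χ : Ell2 (X × Y)) :
    HasSum (fun z => proj (sliceFst z (tensId U Y χ))) (ptraceFst (proj χ)) := by
  have key : ∀ a b, ⟪U a, U b⟫_ℂ = ⟪a, b⟫_ℂ :=
    (LinearMap.norm_map_iff_inner_map_map U).1 hU
  have hs := (summable_proj_sliceFst (tensId U Y χ)).hasSum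
  suffices h : ∑' z, proj (sliceFst z (tensId U Y χ)) = ptraceFst (proj χ) from h ▸ hs
  refine clm_ext_inner_ket fun y y' => ?_
  rw [(hs.inner_ket _ _).unique (hasSum_inner_ket_proj_sliceFst _ y y'),
    ((hasSum_ptraceFst_proj χ).inner_ket _ _).unique (hasSum_inner_ket_proj_sliceFst _ y y'),
    sliceSnd_tensId, sliceSnd_tensId, key]

/-! ## Mixtures of pure states -/

/-- A closed subspace is its own double orthogonal complement. Membership becomes a vanishing of
inner products, which can be tested term by term in a series. -/
theorem ClosedSubmodule.mem_of_forall_inner {E : Type*} [NormedAddCommGroup E]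
    [InnerProductSpace ℂ E] [CompleteSpace E] (K : ClosedSubmodule ℂ E) {ψ : E}
    (h : ∀ η : E, (∀ k ∈ K, ⟪η, k⟫_ℂ = 0) → ⟪η, ψ⟫_ℂ = 0) : ψ ∈ K := by
  have h1 : ψ ∈ K.toSubmoduleᗮᗮ :=
    (Submodule.mem_orthogonal _ _).2 fun η hη => h η fun k hk =>
      (Submodule.mem_orthogonal' _ _).1 hη k hk
  rw [Submodule.orthogonal_orthogonal_eq_closure,
    IsClosed.submodule_topologicalClosure_eq K.isClosed] at h1
  exact h1

open Classical in
/-- The vector `ψ` if the classical memory is `n`, and `0` otherwise. -/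
def loc {M E : Type*} [Zero E] (n : M) (ψ : E) (m : M) : E := if n = m then ψ else 0

@[simp] theorem loc_self {M E : Type*} [Zero E] (n : M) (ψ : E) : loc n ψ n = ψ := if_pos rfl

theorem loc_of_ne {M E : Type*} [Zero E] {n m : M} (h : n ≠ m) (ψ : E) : loc n ψ m = 0 :=
  if_neg h

theorem hasSum_loc {M X : Type*} (n : M) (ψ : Ell2 X) :
    HasSum (fun p : M × X => ‖loc n ψ p.1 p.2‖ ^ 2) (‖ψ‖ ^ 2) := by
  have hi : Function.Injective fun x : X => (n, x) := fun _ _ h => (Prod.mk.inj h).2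
  refine (hi.hasSum_iff ?_).1 ?_
  · rintro ⟨m, x⟩ h
    have : n ≠ m := fun e => h ⟨x, by rw [e]⟩
    simp [loc_of_ne this]
  · simpa [Function.comp_def] using hasSum_ell2_norm_sq ψ

/-- `ρ` is the mixture of the pure states `χ i` at the classical memories `n i`. -/
def IsMix {I M X : Type*} (ρ : CQ M X) (n : I → M) (χ : I → Ell2 X) : Prop :=
  (Summable fun i => ‖χ i‖ ^ 2) ∧ ∀ m, HasSum (fun i => proj (loc (n i) (χ i) m)) (ρ m)

theorem summable_norm_sq_loc {I M X : Type*} {n : I → M} {χ : I → Ell2 X}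
    (h : Summable fun i => ‖χ i‖ ^ 2) (m : M) : Summable fun i => ‖loc (n i) (χ i) m‖ ^ 2 := by
  refine Summable.of_nonneg_of_le (fun _ => sq_nonneg _) (fun i => ?_) h
  by_cases e : n i = m
  · rw [← e, loc_self]
  · simp [loc_of_ne e]

theorem exists_isMix {I M X : Type*} (n : I → M) {χ : I → Ell2 X}
    (h : Summable fun i => ‖χ i‖ ^ 2) : ∃ ρ : CQ M X, IsMix ρ n χ :=
  ⟨fun m => ∑' i, proj (loc (n i) (χ i) m), h, fun m =>
    (summable_proj (summable_norm_sq_loc h m)).of_norm.hasSum⟩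

theorem IsMix.unique {I M X : Type*} {ρ ρ' : CQ M X} {n : I → M} {χ : I → Ell2 X}
    (h : IsMix ρ n χ) (h' : IsMix ρ' n χ) : ρ = ρ' :=
  funext fun m => (h.2 m).unique (h'.2 m)

theorem isPositive_of_hasSum_proj {I X : Type*} {χ : I → Ell2 X} {A : Ell2 X →L[ℂ] Ell2 X}
    (h : HasSum (fun i => proj (χ i)) A) : A.IsPositive :=
  (ContinuousLinearMap.nonneg_iff_isPositive _).1 <| h.nonneg fun _ =>
    (ContinuousLinearMap.nonneg_iff_isPositive _).2 (InnerProductSpace.isPositive_rankOne_self _)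

theorem hasSum_inner_of_hasSum_proj {I X : Type*} {χ : I → Ell2 X} {A : Ell2 X →L[ℂ] Ell2 X}
    (h : HasSum (fun i => proj (χ i)) A) (φ : Ell2 X) :
    HasSum (fun i => ‖⟪χ i, φ⟫_ℂ‖ ^ 2) (RCLike.re ⟪φ, A φ⟫_ℂ) := by
  have h1 : HasSum (fun i => ⟪φ, proj (χ i) φ⟫_ℂ) ⟪φ, A φ⟫_ℂ :=
    h.mapL (innerSL ℂ φ ∘L ContinuousLinearMap.apply ℂ (Ell2 X) φ)
  have h2 := h1.mapL Complex.reCLM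
  refine (congrArg (fun f => HasSum f _) (funext fun i => ?_)).mpr h2
  rw [inner_proj, ← inner_conj_symm φ (χ i), RCLike.conj_mul]
  exact (Complex.ofReal_re _).symm.trans (by push_cast; rfl)

/-- Diagonal entries are sums of squared coordinates of the `χ i`; summing in the other order bounds
the trace by the sum of the `‖χ i‖ ^ 2`. -/
theorem IsMix.isCQ {I M X : Type*} {ρ : CQ M X} {n : I → M} {χ : I → Ell2 X}
    (h : IsMix ρ n χ) : IsCQ ρ := by
  refine ⟨fun m => isPositive_of_hasSum_proj (h.2 m), ?_⟩
  let g : I → M × X → ℝ := fun i q => ‖loc (n i) (χ i) q.1 q.2‖ ^ 2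
  have hg : ∀ i, HasSum (g i) (‖χ i‖ ^ 2) := fun i => hasSum_loc (n i) (χ i)
  have hg0 : ∀ i q, 0 ≤ g i q := fun _ _ => sq_nonneg _
  have h1 := summable_prod_of_hasSum hg0 hg h.1
  have h2 : Summable fun p : (M × X) × I => ‖loc (n p.2) (χ p.2) p.1.1 p.1.2‖ ^ 2 :=
    (Equiv.prodComm (M × X) I).summable_iff.2 h1
  refine (h2.hasSum.prod_fiberwise (g := fun p : M × X =>
    RCLike.re ⟪ket p.2, ρ p.1 (ket p.2)⟫_ℂ) fun p => ?_).summable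
  have h3 := hasSum_inner_of_hasSum_proj (h.2 p.1) (ket p.2)
  simp only [inner_ket_right, RCLike.norm_conj] at h3
  exact h3

theorem IsMix.satisfies {I : Type*} {CV QV : Type*} {TC : CV → Type*} {TQ : QV → Type*}
    {ρ : CQ2 TC TQ} {n : I → Mem (Idx TC)} {χ : I → Ell2 (Mem (Idx TQ))}
    (h : IsMix ρ n χ) {A : QPred TC TQ} (hA : ∀ i, χ i ∈ A (n i)) : Satisfies ρ A := by
  intro m
  refine Submodule.closure_le.2 ?_
  rintro _ ⟨φ, rfl⟩
  refine (A m).mem_of_forall_inner fun η hη => ?_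
  have h1 : HasSum (fun i => ⟪η, proj (loc (n i) (χ i) m) φ⟫_ℂ) ⟪η, ρ m φ⟫_ℂ :=
    (h.2 m).mapL (innerSL ℂ η ∘L ContinuousLinearMap.apply ℂ (Ell2 _) φ)
  refine h1.unique ?_
  convert hasSum_zero using 2 with i
  rw [inner_proj]
  by_cases e : n i = m
  · rw [e, loc_self, hη _ (e ▸ hA i), zero_mul]
  · simp [loc_of_ne e]

/-- For `η` orthogonal to the predicate, `0 = ⟪η, ρ η⟫` is a sum of the nonnegative terms `|⟪χ i,
η⟫|²`, so each of them vanishes. -/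
theorem IsMix.mem_of_satisfies {I : Type*} {CV QV : Type*} {TC : CV → Type*} {TQ : QV → Type*}
    {ρ : CQ2 TC TQ} {n : I → Mem (Idx TC)} {χ : I → Ell2 (Mem (Idx TQ))}
    (h : IsMix ρ n χ) {A : QPred TC TQ} (hA : Satisfies ρ A) (i : I) : χ i ∈ A (n i) := by
  refine (A (n i)).mem_of_forall_inner fun η hη => ?_
  have h0 : ρ (n i) η ∈ A (n i) :=
    hA (n i) (Submodule.le_topologicalClosure _ ⟨η, rfl⟩)
  have h1 := hasSum_inner_of_hasSum_proj (h.2 (n i)) η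
  rw [hη _ h0, map_zero, hasSum_zero_iff_of_nonneg fun _ => sq_nonneg _] at h1
  have h2 := congrFun h1 i
  simp only [loc_self, Pi.zero_apply, ne_eq, OfNat.ofNat_ne_zero, not_false_eq_true,
    pow_eq_zero_iff, norm_eq_zero] at h2
  exact inner_eq_zero_symm.1 h2

/-- This is `S (∑ |x⟩⟨x|) S*`; the Hilbert–Schmidt hypothesis makes it converge in norm. -/
theorem hasSum_proj_ket {X : Type*} (S : Ell2 X →L[ℂ] Ell2 X)
    (hS : Summable fun x => ‖S (ket x)‖ ^ 2) :
    HasSum (fun x => proj (S (ket x))) (S ∘L S.adjoint) := by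
  have h := (summable_proj hS).of_norm.hasSum
  suffices e : ∑' x, proj (S (ket x)) = S ∘L S.adjoint from e ▸ h
  refine clm_ext_inner_ket fun a b => (h.inner_ket a b).unique ?_
  rw [ContinuousLinearMap.comp_apply, ← ContinuousLinearMap.adjoint_inner_left]
  have e : ∀ x, ⟪ket a, proj (S (ket x)) (ket b)⟫_ℂ
      = starRingEnd ℂ (S.adjoint (ket a) x) * S.adjoint (ket b) x := by
    intro x
    rw [inner_proj, ← ContinuousLinearMap.adjoint_inner_left, inner_ket_right,
      ← ContinuousLinearMap.adjoint_inner_right, inner_ket_left]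
  simp only [e]
  exact ell2_hasSum_inner _ _

theorem ContinuousLinearMap.IsPositive.exists_sqrt {E : Type*} [NormedAddCommGroup E]
    [InnerProductSpace ℂ E] [CompleteSpace E] {T : E →L[ℂ] E} (hT : T.IsPositive) :
    ∃ S : E →L[ℂ] E, S.adjoint = S ∧ S ∘L S = T :=
  ⟨CFC.sqrt T,
    ((ContinuousLinearMap.nonneg_iff_isPositive _).1 (CFC.sqrt_nonneg T)).isSelfAdjoint,
    CFC.sqrt_mul_sqrt_self _ ((ContinuousLinearMap.nonneg_iff_isPositive _).2 hT)⟩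

/-- With `S` the positive square root of `σ m`, the vectors `S |x⟩` decompose `σ m = S S*`, so no
eigenvectors are needed. Their squared norms are the diagonal entries of `σ m`, which controls
summability later. -/
theorem IsCQ.exists_isMix {M X : Type*} {σ : CQ M X} (h : IsCQ σ) :
    ∃ χ : M × X → Ell2 X, IsMix σ Prod.fst χ ∧
      ∀ p, ⟪ket p.2, σ p.1 (ket p.2)⟫_ℂ = ((‖χ p‖ ^ 2 : ℝ) : ℂ) := by
  choose S hs hq using fun m => (h.1 m).exists_sqrt
  have hn : ∀ p : M × X, ⟪ket p.2, σ p.1 (ket p.2)⟫_ℂ = ((‖S p.1 (ket p.2)‖ ^ 2 : ℝ) : ℂ) := by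
    intro p
    have h1 := inner_self_eq_norm_sq_to_K (𝕜 := ℂ) (S p.1 (ket p.2))
    rw [← ContinuousLinearMap.adjoint_inner_right, hs] at h1
    rw [← hq]
    push_cast
    exact h1
  have hS : Summable fun p : M × X => ‖S p.1 (ket p.2)‖ ^ 2 := by
    have h2 := h.2
    simp only [hn] at h2
    exact h2
  refine ⟨fun p => S p.1 (ket p.2), ⟨hS, fun m => ?_⟩, hn⟩
  have hi : Function.Injective fun x : X => (m, x) := fun _ _ h => (Prod.mk.inj h).2
  refine (hi.hasSum_iff ?_).1 ?_
  · rintro ⟨n, x⟩ h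
    have : n ≠ m := fun e => h ⟨x, by rw [← e]⟩
    simp [loc_of_ne this]
  · have hm := hS.comp_injective hi
    simp only [Function.comp_def] at hm
    have := hasSum_proj_ket (S m) hm
    rw [hs, hq] at this
    simpa [Function.comp_def] using this

/-! ### Product states of two memories: separability and marginals. -/

section Pairs

variable {CV QV : Type*} {TC : CV → Type*} {TQ : QV → Type*}

/-- The product state of the two memories. -/
def pairVec (ψ φ : Ell2 (Mem TQ)) : Ell2 (Mem (Idx TQ)) :=
  (reindex (pairMem TQ)).symm (tvec ψ φ)

theorem pairVec_apply (ψ φ : Ell2 (Mem TQ)) (m : Mem (Idx TQ)) :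
    pairVec ψ φ m = ψ (pairMem TQ m).1 * φ (pairMem TQ m).2 := rfl

theorem norm_pairVec (ψ φ : Ell2 (Mem TQ)) : ‖pairVec ψ φ‖ = ‖ψ‖ * ‖φ‖ := by
  rw [pairVec, LinearIsometryEquiv.norm_map, norm_tvec]

theorem pairVec_zero_left (φ : Ell2 (Mem TQ)) : pairVec 0 φ = 0 := by
  ext m; simp [pairVec_apply]

theorem pairVec_zero_right (ψ : Ell2 (Mem TQ)) : pairVec ψ 0 = 0 := by
  ext m; simp [pairVec_apply]

theorem pairVec_smul_right (c : ℂ) (ψ φ : Ell2 (Mem TQ)) :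
    pairVec ψ (c • φ) = c • pairVec ψ φ := by
  ext m; simp [pairVec_apply]; ring

/-- The pair of classical memories `m₁`, `m₂`. -/
abbrev pairC (m₁ m₂ : Mem TC) : Mem (Idx TC) := (pairMem TC).symm (m₁, m₂)

theorem loc_pairVec (m₁ m₂ : Mem TC) (ψ φ : Ell2 (Mem TQ)) (n : Mem (Idx TC)) :
    loc (pairC m₁ m₂) (pairVec ψ φ) n
      = pairVec (loc m₁ ψ (pairMem TC n).1) (loc m₂ φ (pairMem TC n).2) := by
  by_cases h1 : m₁ = (pairMem TC n).1
  · by_cases h2 : m₂ = (pairMem TC n).2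
    · have : pairC m₁ m₂ = n := (Equiv.symm_apply_eq _).2 (by rw [h1, h2])
      rw [← h1, ← h2, this, loc_self, loc_self, loc_self]
    · have : pairC m₁ m₂ ≠ n := fun e => h2 (by rw [← e, Equiv.apply_symm_apply])
      rw [loc_of_ne this, loc_of_ne h2, pairVec_zero_right]
  · have : pairC m₁ m₂ ≠ n := fun e => h1 (by rw [← e, Equiv.apply_symm_apply])
    rw [loc_of_ne this, loc_of_ne h1, pairVec_zero_left]

theorem conjBy_tens_proj (ψ φ : Ell2 (Mem TQ)) :
    conjBy (pairMem TQ) (tens (proj ψ) (proj φ)) = proj (pairVec ψ φ) := by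
  rw [tens_proj, conjBy_proj, pairVec]

theorem proj_loc_pairVec (m₁ m₂ : Mem TC) (ψ φ : Ell2 (Mem TQ)) (n : Mem (Idx TC)) :
    proj (loc (pairC m₁ m₂) (pairVec ψ φ) n)
      = conjBy (pairMem TQ) (tens (proj (loc m₁ ψ (pairMem TC n).1))
        (proj (loc m₂ φ (pairMem TC n).2))) := by
  rw [loc_pairVec, conjBy_tens_proj]

theorem isCQ_proj_loc {M X : Type*} (n : M) (ψ : Ell2 X) : IsCQ fun m => proj (loc n ψ m) :=
  IsMix.isCQ (I := Unit) (n := fun _ => n) (χ := fun _ => ψ)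
    ⟨(hasSum_fintype _).summable, fun m => by
      simp⟩

theorem isCQ_zero {M X : Type*} : IsCQ (0 : CQ M X) :=
  IsMix.isCQ (I := Empty) (n := Empty.elim) (χ := Empty.elim)
    ⟨(hasSum_fintype _).summable, fun _ => hasSum_empty⟩

/-- Summability leaves only countably many nonzero vectors, which are numbered by `ℕ` and padded
with zero operators. -/
theorem IsMix.separable {I : Type*} {ρ : CQ2 TC TQ} {m₁ m₂ : I → Mem TC}
    {ψ φ : I → Ell2 (Mem TQ)}
    (h : IsMix ρ (fun i => pairC (m₁ i) (m₂ i)) fun i => pairVec (ψ i) (φ i)) :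
    Separable ρ := by
  have hc := h.1.countable_support
  set s := Function.support fun i => ‖pairVec (ψ i) (φ i)‖ ^ 2 with hs
  have : Countable s := hc
  obtain ⟨f, hf⟩ := exists_injective_nat s
  have hCQ : ∀ (g : s → CQ1 TC TQ), (∀ i, IsCQ (g i)) → ∀ k, IsCQ (Function.extend f g 0 k) := by
    intro g hg k
    by_cases hk : ∃ i, f i = k
    · obtain ⟨i, rfl⟩ := hk
      rw [hf.extend_apply]
      exact hg i
    · rw [Function.extend_apply' _ _ _ hk]
      exact isCQ_zero
  refine ⟨Function.extend f (fun i m => proj (loc (m₁ i) (ψ i) m)) 0,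
    Function.extend f (fun i m => proj (loc (m₂ i) (φ i) m)) 0,
    hCQ _ fun i => isCQ_proj_loc _ _, hCQ _ fun i => isCQ_proj_loc _ _, fun n => ?_⟩
  have h1 : HasSum (fun i : s => proj (loc (pairC (m₁ i) (m₂ i)) (pairVec (ψ i) (φ i)) n)) (ρ n) := by
    refine (hasSum_subtype_iff_of_support_subset (s := s)
      (f := fun i => proj (loc (pairC (m₁ i) (m₂ i)) (pairVec (ψ i) (φ i)) n))
      fun i hi => ?_).2 (h.2 n)
    rw [hs, Function.mem_support]
    intro h0
    refine hi ?_
    have : pairVec (ψ i) (φ i) = 0 := norm_eq_zero.1 (pow_eq_zero_iff two_ne_zero |>.1 h0)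
    simp [this, loc]
  rw [← hasSum_extend_zero hf] at h1
  convert h1 using 2 with k
  by_cases hk : ∃ i, f i = k
  · obtain ⟨i, rfl⟩ := hk
    simp only [hf.extend_apply, proj_loc_pairVec]
  · simp only [Function.extend_apply' _ _ _ hk, Pi.zero_apply]
    rw [← proj_zero, ← proj_zero, conjBy_tens_proj, pairVec_zero_left]

theorem inner_ket_conjBy_tens (A B : Ell2 (Mem TQ) →L[ℂ] Ell2 (Mem TQ)) (x : Mem (Idx TQ)) :
    ⟪ket x, conjBy (pairMem TQ) (tens A B) (ket x)⟫_ℂ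
      = ⟪ket (pairMem TQ x).1, A (ket (pairMem TQ x).1)⟫_ℂ
        * ⟪ket (pairMem TQ x).2, B (ket (pairMem TQ x).2)⟫_ℂ := by
  have : reindex (pairMem TQ) (ket x) = ket (pairMem TQ x) := by
    ext y
    rw [reindex_apply, ket_apply, ket_apply]
    by_cases hy : y = pairMem TQ x
    · rw [if_pos hy, if_pos ((Equiv.symm_apply_eq _).2 hy)]
    · rw [if_neg hy, if_neg fun h => hy ((Equiv.symm_apply_eq _).1 h)]
  rw [inner_ket_left, inner_ket_left, inner_ket_left, conjBy_apply, this, ket_prod, tens_tvec,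
    tvec_apply]

/-- Each tensor factor is split into pure states. The weights are summable because each is a part of
a diagonal entry of `ρ`, whose trace is finite. -/
theorem Separable.exists_isMix {ρ : CQ2 TC TQ} (h : Separable ρ) (hρ : IsCQ ρ) :
    ∃ (m₁ m₂ : ℕ × (Mem TC × Mem TQ) × (Mem TC × Mem TQ) → Mem TC)
      (ψ φ : ℕ × (Mem TC × Mem TQ) × (Mem TC × Mem TQ) → Ell2 (Mem TQ)),
      IsMix ρ (fun i => pairC (m₁ i) (m₂ i)) fun i => pairVec (ψ i) (φ i) := by
  obtain ⟨σ, τ, hσ, hτ, hs⟩ := h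
  choose χ hχ hχn using fun k => (hσ k).exists_isMix
  choose κ hκ hκn using fun k => (hτ k).exists_isMix
  refine ⟨fun i => i.2.1.1, fun i => i.2.2.1, fun i => χ i.1 i.2.1, fun i => κ i.1 i.2.2, ?_⟩
  have hsum : Summable fun i : ℕ × (Mem TC × Mem TQ) × (Mem TC × Mem TQ) =>
      ‖pairVec (χ i.1 i.2.1) (κ i.1 i.2.2)‖ ^ 2 := by
    let g : Mem (Idx TC) × Mem (Idx TQ) → ℕ → ℝ := fun p k =>
      ‖χ k ((pairMem TC p.1).1, (pairMem TQ p.2).1)‖ ^ 2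
        * ‖κ k ((pairMem TC p.1).2, (pairMem TQ p.2).2)‖ ^ 2
    have hg : ∀ p, HasSum (g p) (RCLike.re ⟪ket p.2, ρ p.1 (ket p.2)⟫_ℂ) := by
      intro p
      have h1 := ((hs p.1).inner_ket p.2 p.2).mapL Complex.reCLM
      refine (congrArg (fun f => HasSum f _) (funext fun k => ?_)).mpr h1
      have e := inner_ket_conjBy_tens (σ k (pairMem TC p.1).1) (τ k (pairMem TC p.1).2) p.2
      rw [hχn k ((pairMem TC p.1).1, (pairMem TQ p.2).1),
        hκn k ((pairMem TC p.1).2, (pairMem TQ p.2).2), ← Complex.ofReal_mul] at e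
      rw [e]
      exact (Complex.ofReal_re _).symm
    have h2 := summable_prod_of_hasSum (fun _ _ => by positivity) hg hρ.2
    -- An index of the mixture amounts to a diagonal position of `ρ` together with the number `k` of
    -- a summand.
    have hi : Function.Injective fun i : ℕ × (Mem TC × Mem TQ) × (Mem TC × Mem TQ) =>
        ((pairC i.2.1.1 i.2.2.1, (pairMem TQ).symm (i.2.1.2, i.2.2.2)), i.1) := by
      rintro ⟨k, ⟨a, b⟩, c, d⟩ ⟨k', ⟨a', b'⟩, c', d'⟩ e
      simp only [Prod.mk.injEq, EmbeddingLike.apply_eq_iff_eq] at e ⊢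
      tauto
    have h3 := h2.comp_injective hi
    simp only [norm_pairVec, mul_pow]
    exact h3
  refine ⟨hsum, fun n => ?_⟩
  have hF := (summable_proj (summable_norm_sq_loc (n := fun i => pairC i.2.1.1 i.2.2.1)
    hsum n)).of_norm
  suffices h1 : ∑' i : ℕ × (Mem TC × Mem TQ) × (Mem TC × Mem TQ), proj (loc (pairC i.2.1.1 i.2.2.1)
      (pairVec (χ i.1 i.2.1) (κ i.1 i.2.2)) n) = ρ n from h1 ▸ hF.hasSum
  refine (hF.hasSum.prod_fiberwise fun k => ?_).unique (hs n)
  have hk := (hF.prod_factor k).hasSum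
  -- For fixed `k`, sum first over the pure parts of `τ k`, then over those of `σ k`.
  have h1 := hk.prod_fiberwise (g := fun p => conjBy (pairMem TQ)
    (tens (proj (loc p.1 (χ k p) (pairMem TC n).1)) (τ k (pairMem TC n).2))) fun p => by
      simp only [proj_loc_pairVec]
      exact (((hκ k).2 (pairMem TC n).2).tens_right _).conjBy _
  have h2 := (((hχ k).2 (pairMem TC n).1).tens_left (τ k (pairMem TC n).2)).conjBy (pairMem TQ)
  rw [← h1.unique h2]
  exact hk

theorem loc_smul {M X : Type*} (n : M) (c : ℂ) (ψ : Ell2 X) (m : M) :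
    loc n (c • ψ) m = c • loc n ψ m := by
  by_cases e : n = m
  · rw [← e, loc_self, loc_self]
  · rw [loc_of_ne e, loc_of_ne e, smul_zero]

theorem hasSum_norm_sq_loc {M X : Type*} (n : M) (ψ : Ell2 X) :
    HasSum (fun m => ‖loc n ψ m‖ ^ 2) (‖ψ‖ ^ 2) := by
  convert hasSum_single (f := fun m => ‖loc n ψ m‖ ^ 2) n fun m hm => ?_
  · simp
  · simp [loc_of_ne hm.symm]

theorem norm_loc_le {M X : Type*} (n : M) (ψ : Ell2 X) (m : M) : ‖loc n ψ m‖ ≤ ‖ψ‖ := by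
  by_cases e : n = m
  · rw [← e, loc_self]
  · simp [loc_of_ne e]

theorem conjBy_symm_proj_loc_pairVec (m₁ m₂ n₁ n₂ : Mem TC) (ψ φ : Ell2 (Mem TQ)) :
    conjBy (pairMem TQ).symm (proj (loc (pairC m₁ m₂) (pairVec ψ φ) (pairC n₁ n₂)))
      = proj (tvec (loc m₁ ψ n₁) (loc m₂ φ n₂)) := by
  rw [conjBy_proj, loc_pairVec, Equiv.apply_symm_apply]
  rfl

/-- Tracing out one factor of a product vector multiplies the other by the norm of the lost one. The
rest is the exchange of sums over mixture indices and over the traced-out classical memory. -/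
theorem IsMix.tr2 {I : Type*} {ρ : CQ2 TC TQ} {m₁ m₂ : I → Mem TC}
    {ψ φ : I → Ell2 (Mem TQ)}
    (h : IsMix ρ (fun i => pairC (m₁ i) (m₂ i)) fun i => pairVec (ψ i) (φ i)) :
    IsMix (tr2 ρ) m₁ fun i => (‖φ i‖ : ℂ) • ψ i := by
  have hs : Summable fun i => ‖ψ i‖ ^ 2 * ‖φ i‖ ^ 2 := by
    simpa only [norm_pairVec, mul_pow] using h.1
  refine ⟨by simpa only [norm_smul, Complex.norm_real, norm_norm, mul_pow, mul_comm] using hs,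
    fun n₁ => ?_⟩
  have hsn : Summable fun i => ‖loc (m₁ i) (ψ i) n₁‖ ^ 2 * ‖φ i‖ ^ 2 :=
    hs.of_nonneg_of_le (fun _ => by positivity) fun i => by
      gcongr
      exact norm_loc_le _ _ _
  have h1 : ∀ n₂, HasSum (fun i => proj ((‖loc (m₂ i) (φ i) n₂‖ : ℂ) • loc (m₁ i) (ψ i) n₁))
      (ptraceSnd (conjBy (pairMem TQ).symm (ρ (pairC n₁ n₂)))) := by
    intro n₂
    have h2 := (h.2 (pairC n₁ n₂)).conjBy (pairMem TQ).symm
    simp only [conjBy_symm_proj_loc_pairVec] at h2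
    have h3 := hasSum_ptraceSnd (by
      simp only [norm_tvec, mul_pow]
      refine hsn.of_nonneg_of_le (fun _ => by positivity) fun i => ?_
      gcongr
      exact norm_loc_le _ _ _) h2
    simp only [ptraceSnd_proj_tvec] at h3
    exact h3
  have h2 : _root_.tr2 ρ n₁
      = ∑' n₂, ∑' i, proj ((‖loc (m₂ i) (φ i) n₂‖ : ℂ) • loc (m₁ i) (ψ i) n₁) :=
    tsum_congr fun n₂ => (h1 n₂).tsum_eq.symm
  rw [h2]
  refine hasSum_tsum_tsum (f := fun i n₂ =>
    proj ((‖loc (m₂ i) (φ i) n₂‖ : ℂ) • loc (m₁ i) (ψ i) n₁)) ?_ fun i => ?_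
  · simp only [norm_proj, norm_smul, Complex.norm_real, norm_norm, mul_pow]
    refine summable_prod_of_hasSum
      (g := fun i n₂ => ‖loc (m₂ i) (φ i) n₂‖ ^ 2 * ‖loc (m₁ i) (ψ i) n₁‖ ^ 2)
      (fun _ _ => by positivity) (fun i => (hasSum_norm_sq_loc (m₂ i) (φ i)).mul_right _) ?_
    simpa only [mul_comm] using hsn
  -- A single component sits at one right classical memory, so only `n₂ = m₂ i` contributes.
  · have h3 := hasSum_single (f := fun n₂ =>
      proj ((‖loc (m₂ i) (φ i) n₂‖ : ℂ) • loc (m₁ i) (ψ i) n₁)) (m₂ i) fun n₂ hn => by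
        simp [loc_of_ne hn.symm]
    simpa only [loc_self, loc_smul] using h3

theorem IsMix.tr1 {I : Type*} {ρ : CQ2 TC TQ} {m₁ m₂ : I → Mem TC}
    {ψ φ : I → Ell2 (Mem TQ)}
    (h : IsMix ρ (fun i => pairC (m₁ i) (m₂ i)) fun i => pairVec (ψ i) (φ i)) :
    IsMix (tr1 ρ) m₂ fun i => (‖ψ i‖ : ℂ) • φ i := by
  have hs : Summable fun i => ‖ψ i‖ ^ 2 * ‖φ i‖ ^ 2 := by
    simpa only [norm_pairVec, mul_pow] using h.1
  refine ⟨by simpa only [norm_smul, Complex.norm_real, norm_norm, mul_pow] using hs,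
    fun n₂ => ?_⟩
  have hsn : Summable fun i => ‖ψ i‖ ^ 2 * ‖loc (m₂ i) (φ i) n₂‖ ^ 2 :=
    hs.of_nonneg_of_le (fun _ => by positivity) fun i => by
      gcongr
      exact norm_loc_le _ _ _
  have h1 : ∀ n₁, HasSum (fun i => proj ((‖loc (m₁ i) (ψ i) n₁‖ : ℂ) • loc (m₂ i) (φ i) n₂))
      (ptraceFst (conjBy (pairMem TQ).symm (ρ (pairC n₁ n₂)))) := by
    intro n₁
    have h2 := (h.2 (pairC n₁ n₂)).conjBy (pairMem TQ).symm
    simp only [conjBy_symm_proj_loc_pairVec] at h2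
    have h3 := hasSum_ptraceFst (by
      simp only [norm_tvec, mul_pow]
      refine hsn.of_nonneg_of_le (fun _ => by positivity) fun i => ?_
      gcongr
      exact norm_loc_le _ _ _) h2
    simp only [ptraceFst_proj_tvec] at h3
    exact h3
  have h2 : _root_.tr1 ρ n₂
      = ∑' n₁, ∑' i, proj ((‖loc (m₁ i) (ψ i) n₁‖ : ℂ) • loc (m₂ i) (φ i) n₂) :=
    tsum_congr fun n₁ => (h1 n₁).tsum_eq.symm
  rw [h2]
  refine hasSum_tsum_tsum (f := fun i n₁ =>
    proj ((‖loc (m₁ i) (ψ i) n₁‖ : ℂ) • loc (m₂ i) (φ i) n₂)) ?_ fun i => ?_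
  · simp only [norm_proj, norm_smul, Complex.norm_real, norm_norm, mul_pow]
    exact summable_prod_of_hasSum
      (g := fun i n₁ => ‖loc (m₁ i) (ψ i) n₁‖ ^ 2 * ‖loc (m₂ i) (φ i) n₂‖ ^ 2)
      (fun _ _ => by positivity) (fun i => (hasSum_norm_sq_loc (m₁ i) (ψ i)).mul_right _) hsn
  · have h3 := hasSum_single (f := fun n₁ =>
      proj ((‖loc (m₁ i) (ψ i) n₁‖ : ℂ) • loc (m₂ i) (φ i) n₂)) (m₁ i) fun n₁ hn => by
        simp [loc_of_ne hn.symm]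
    simpa only [loc_self, loc_smul] using h3

end Pairs

/-! ## Contractions and closed subspaces of tensor products -/

/-- The operator `⟨w| ⊗ id : ℓ²(X × Y) → ℓ²(Y)`. -/
def contract {X : Type*} (w : Ell2 X) (Y : Type*) : Ell2 (X × Y) →L[ℂ] Ell2 Y :=
  sliceFst () ∘L tensId (InnerProductSpace.rankOne ℂ (ket ()) w) Y

theorem contract_apply {X Y : Type*} (w : Ell2 X) (ψ : Ell2 (X × Y)) (y : Y) :
    contract w Y ψ y = ⟪w, sliceSnd y ψ⟫_ℂ := by
  change ⟪w, sliceSnd y ψ⟫_ℂ * ket () () = _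
  simp [ket_apply]

theorem tensId_tvec {X X' Y : Type*} (A : Ell2 X →L[ℂ] Ell2 X') (ψ : Ell2 X) (φ : Ell2 Y) :
    tensId A Y (tvec ψ φ) = tvec (A ψ) φ := by
  ext p
  simp [mul_comm]

/-- An operator on one factor commutes with a functional on the other; by continuity it suffices to
compare on basis vectors. -/
theorem inner_sliceFst_tensId {X X' Y : Type*} (A : Ell2 X →L[ℂ] Ell2 X') (ψ : Ell2 (X × Y))
    (η : Ell2 Y) (x : X') :
    ⟪η, sliceFst x (tensId A Y ψ)⟫_ℂ
      = A (contract η X (reindex (Equiv.prodComm X Y) ψ)) x := by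
  have h : innerSL ℂ η ∘L sliceFst x ∘L tensId A Y =
      innerSL ℂ (ket x) ∘L A ∘L contract η X ∘L
        (reindex (Equiv.prodComm X Y) : Ell2 (X × Y) →L[ℂ] Ell2 (Y × X)) := by
    refine clm_ext_ket fun p => ?_
    have e : contract η X (reindex (Equiv.prodComm X Y) (tvec (ket p.1) (ket p.2)))
        = ⟪η, ket p.2⟫_ℂ • ket p.1 := by
      ext x
      have : sliceSnd x (reindex (Equiv.prodComm X Y) (tvec (ket p.1) (ket p.2)))
        = ket p.1 x • ket p.2 := by
        ext y; simp
      rw [contract_apply, this, inner_smul_right, mul_comm]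
      rfl
    change ⟪η, sliceFst x (tensId A Y (ket p))⟫_ℂ = ⟪ket x, A (contract η X (reindex _ (ket p)))⟫_ℂ
    rw [inner_ket_left, ket_prod, tensId_tvec, sliceFst_tvec, e, map_smul, inner_smul_right,
      mul_comm]
    rfl
  have := congrArg (fun B : Ell2 (X × Y) →L[ℂ] ℂ => B ψ) h
  exact this.trans (inner_ket_left _ _)

theorem inner_tvec_ket_left {X Y : Type*} (η : Ell2 (X × Y)) (x : X) (φ : Ell2 Y) :
    ⟪η, tvec (ket x) φ⟫_ℂ = ⟪sliceFst x η, φ⟫_ℂ := by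
  refine (hasSum_inner_sliceFst _ _).unique ?_
  have h := hasSum_single (f := fun x' => ⟪sliceFst x' η, sliceFst x' (tvec (ket x) φ)⟫_ℂ) x
    fun x' hx => by simp [ket_apply, hx]
  simpa [ket_apply] using h

theorem inner_tvec_ket_right {X Y : Type*} (η : Ell2 (X × Y)) (φ : Ell2 X) (y : Y) :
    ⟪η, tvec φ (ket y)⟫_ℂ = ⟪sliceSnd y η, φ⟫_ℂ := by
  refine (hasSum_inner_sliceSnd _ _).unique ?_
  have h := hasSum_single (f := fun y' => ⟪sliceSnd y' η, sliceSnd y' (tvec φ (ket y))⟫_ℂ) y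
    fun x' hx => by simp [ket_apply, hx]
  simpa [ket_apply] using h

/-- A closed subspace containing all `|x₀⟩⟨x| ⊗ id` images of `ψ` contains its `A ⊗ id` image. -/
theorem tensId_mem_of_ket {X X' Y : Type*} (K : ClosedSubmodule ℂ (Ell2 (X' × Y)))
    {ψ : Ell2 (X × Y)} (h : ∀ x x₀, tvec (ket x₀) (sliceFst x ψ) ∈ K)
    (A : Ell2 X →L[ℂ] Ell2 X') : tensId A Y ψ ∈ K := by
  refine K.mem_of_forall_inner fun η hη => ?_
  refine (hasSum_inner_sliceFst _ _).unique ?_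
  convert hasSum_zero using 2 with x₀
  rw [inner_sliceFst_tensId]
  have : contract (sliceFst x₀ η) X (reindex (Equiv.prodComm X Y) ψ) = 0 := by
    ext x
    rw [contract_apply]
    exact (inner_tvec_ket_left η x₀ (sliceFst x ψ)).symm.trans (hη _ (h x x₀))
  rw [this, map_zero]
  rfl

/-- The slice condition is closed and holds on generators. Conversely, a vector is weakly the sum of
its slices tensored with basis vectors, and each of these is a generator. -/
theorem mem_tensTop_iff {M X Y : Type*} (e : M ≃ X × Y) (S : ClosedSubmodule ℂ (Ell2 X))
    (ψ : Ell2 M) : ψ ∈ tensTop e S.toSubmodule ↔ ∀ y, sliceSnd y (reindex e ψ) ∈ S := by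
  constructor
  · intro h y
    have : tensTop e S.toSubmodule ≤
        S.comap (sliceSnd y ∘L (reindex e : Ell2 M →L[ℂ] Ell2 (X × Y))) := by
      refine Submodule.closure_le.2 (Submodule.span_le.2 ?_)
      rintro χ ⟨a, ha, φ, hχ⟩
      change sliceSnd y (reindex e χ) ∈ S
      have : sliceSnd y (reindex e χ) = φ y • a := by
        ext x
        simp [hχ, mul_comm]
      rw [this]
      exact S.toSubmodule.smul_mem _ ha
    exact this h
  · intro h
    refine (tensTop e S.toSubmodule).mem_of_forall_inner fun η hη => ?_
    rw [← LinearIsometryEquiv.inner_map_map (reindex e)]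
    refine (hasSum_inner_sliceSnd _ _).unique ?_
    convert hasSum_zero using 2 with y
    have h1 : (reindex e).symm (tvec (sliceSnd y (reindex e ψ)) (ket y))
        ∈ tensTop e S.toSubmodule :=
      Submodule.le_topologicalClosure _ (Submodule.subset_span ⟨_, h y, ket y, fun _ => rfl⟩)
    have h2 := hη _ h1
    rw [← LinearIsometryEquiv.inner_map_map (reindex e), LinearIsometryEquiv.apply_symm_apply,
      inner_tvec_ket_right] at h2
    exact h2

/-! ## Acting on a list of variables -/

section Lists

variable {V ι : Type*} {T : V → Type*}

/-- The memory `m` with the variables `Q` overwritten by `x`. -/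
def upd (Q : ι ↪ V) (m : Mem T) (x : Vals T Q) : Mem T :=
  (splitMem T Q).symm (x, (splitMem T Q m).2)

theorem splitMem_upd (Q : ι ↪ V) (m : Mem T) (x : Vals T Q) :
    splitMem T Q (upd Q m x) = (x, (splitMem T Q m).2) := Equiv.apply_symm_apply _ _

theorem upd_apply (Q : ι ↪ V) (m : Mem T) (x : Vals T Q) (i : ι) : upd Q m x (Q i) = x i := by
  rw [← splitMem_fst T Q (upd Q m x), splitMem_upd]

theorem upd_of_notMem (Q : ι ↪ V) (m : Mem T) (x : Vals T Q) {v : V} (h : v ∉ Set.range Q) :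
    upd Q m x v = m v := by
  have := splitMem_snd T Q (upd Q m x) ⟨v, h⟩
  rw [splitMem_upd] at this
  exact this.symm

theorem eq_upd (Q : ι ↪ V) {m m' : Mem T} {x : Vals T Q} (h : ∀ i, m' (Q i) = x i)
    (h' : ∀ v, v ∉ Set.range Q → m' v = m v) : m' = upd Q m x := by
  funext v
  by_cases hv : v ∈ Set.range Q
  · obtain ⟨i, rfl⟩ := hv
    rw [h, upd_apply]
  · rw [h' v hv, upd_of_notMem Q m x hv]

theorem upd_self (Q : ι ↪ V) (m : Mem T) : upd Q m (fun i => m (Q i)) = m :=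
  (eq_upd Q (fun _ => rfl) fun _ _ => rfl).symm

/-- The state of the variables `Q` when all other variables have the values given by `m`. -/
def sl (Q : ι ↪ V) (ψ : Ell2 (Mem T)) (m : Mem T) : Ell2 (Vals T Q) :=
  sliceSnd (splitMem T Q m).2 (reindex (splitMem T Q) ψ)

theorem sl_apply (Q : ι ↪ V) (ψ : Ell2 (Mem T)) (m : Mem T) (x : Vals T Q) :
    sl Q ψ m x = ψ (upd Q m x) := rfl

theorem sl_upd (Q : ι ↪ V) (ψ : Ell2 (Mem T)) (m : Mem T) (x : Vals T Q) :
    sl Q ψ (upd Q m x) = sl Q ψ m := by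
  rw [sl, splitMem_upd]
  rfl

theorem sl_apply_self (Q : ι ↪ V) (ψ : Ell2 (Mem T)) (m : Mem T) :
    sl Q ψ m (fun i => m (Q i)) = ψ m := by
  rw [sl_apply, upd_self]

theorem liftOp_apply (Q : ι ↪ V) (A : Ell2 (Vals T Q) →L[ℂ] Ell2 (Vals T Q)) (ψ : Ell2 (Mem T))
    (m : Mem T) : liftOp T Q A ψ m = A (sl Q ψ m) (fun i => m (Q i)) := rfl

/-- The operator that discards the variables `Q` in the state `w` and reinitializes them in the
state `e`. -/
def swapState (Q : ι ↪ V) (e w : Ell2 (Vals T Q)) : Ell2 (Mem T) →L[ℂ] Ell2 (Mem T) :=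
  liftOp T Q (InnerProductSpace.rankOne ℂ e w)

theorem swapState_apply (Q : ι ↪ V) (e w : Ell2 (Vals T Q)) (ψ : Ell2 (Mem T)) (m : Mem T) :
    swapState Q e w ψ m = ⟪w, sl Q ψ m⟫_ℂ * e (fun i => m (Q i)) := rfl

theorem swapState_eq (Q : ι ↪ V) (e w : Ell2 (Vals T Q)) (ψ : Ell2 (Mem T)) :
    swapState Q e w ψ =
      (reindex (splitMem T Q)).symm (tvec e (contract w _ (reindex (splitMem T Q) ψ))) := by
  ext m
  rw [swapState_apply, reindex_symm_apply, tvec_apply, contract_apply, mul_comm]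
  rfl

theorem swapState_mem_tensTop (Q : ι ↪ V) (e w : Ell2 (Vals T Q)) (ψ : Ell2 (Mem T)) :
    swapState Q e w ψ ∈ tensTop (splitMem T Q) (Submodule.span ℂ {e}) := by
  rw [swapState_eq]
  exact Submodule.le_topologicalClosure _ (Submodule.subset_span
    ⟨e, Submodule.mem_span_singleton_self e, _, fun _ => rfl⟩)

theorem contract_adjoint_ket {X Y Z : Type*} (U : Ell2 X →L[ℂ] Ell2 Z) (z : Z)
    (χ : Ell2 (X × Y)) :
    contract (U.adjoint (ket z)) Y χ = sliceFst z (tensId U Y χ) := by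
  ext y
  rw [contract_apply, ContinuousLinearMap.adjoint_inner_left, inner_ket_left]
  rfl

/-- The weights of the outcomes of measuring `Q`, embedded by `U`, in the basis of `Z` add up to the
whole because `U` preserves norms. -/
theorem hasSum_norm_sq_swapState {Z : Type*} (Q : ι ↪ V) {e : Ell2 (Vals T Q)} (he : ‖e‖ = 1)
    {U : Ell2 (Vals T Q) →L[ℂ] Ell2 Z} (hU : ∀ ψ, ‖U ψ‖ = ‖ψ‖) (ψ : Ell2 (Mem T)) :
    HasSum (fun z => ‖swapState Q e (U.adjoint (ket z)) ψ‖ ^ 2) (‖ψ‖ ^ 2) := by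
  have h := hasSum_sliceFst_norm_sq (tensId U _ (reindex (splitMem T Q) ψ))
  rw [norm_tensId_apply hU, LinearIsometryEquiv.norm_map] at h
  simpa only [swapState_eq, LinearIsometryEquiv.norm_map, norm_tvec, he, one_mul,
    contract_adjoint_ket] using h

/-- Initialization of the variables `Q` with the state `e`, on density operators. -/
def initOp (Q : ι ↪ V) (e : Ell2 (Vals T Q)) (A : Ell2 (Mem T) →L[ℂ] Ell2 (Mem T)) :
    Ell2 (Mem T) →L[ℂ] Ell2 (Mem T) :=
  conjBy (splitMem T Q) (tens (proj e) (ptraceFst (conjBy (splitMem T Q).symm A)))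

theorem hasSum_initOp {I : Type*} (Q : ι ↪ V) (e : Ell2 (Vals T Q)) {χ : I → Ell2 (Mem T)}
    (h : Summable fun i => ‖χ i‖ ^ 2) {A : Ell2 (Mem T) →L[ℂ] Ell2 (Mem T)}
    (hA : HasSum (fun i => proj (χ i)) A) :
    HasSum (fun i => initOp Q e (proj (χ i))) (initOp Q e A) := by
  have h1 := hA.conjBy (splitMem T Q).symm
  simp only [conjBy_proj] at h1
  have h2 := hasSum_ptraceFst (by simpa only [LinearIsometryEquiv.norm_map] using h) h1
  simp only [initOp, conjBy_proj]
  exact (h2.tens_right (proj e)).conjBy _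

/-- A Kraus decomposition of the initialization: the discarded register may be embedded by `U` and
traced out in the basis of `Z`. This freedom lets the two programs use outcomes from the same set.
-/
theorem hasSum_initOp_proj {Z : Type*} (Q : ι ↪ V) (e : Ell2 (Vals T Q))
    {U : Ell2 (Vals T Q) →L[ℂ] Ell2 Z} (hU : ∀ ψ, ‖U ψ‖ = ‖ψ‖) (ψ : Ell2 (Mem T)) :
    HasSum (fun z => proj (swapState Q e (U.adjoint (ket z)) ψ)) (initOp Q e (proj ψ)) := by
  have h := hasSum_proj_sliceFst_tensId hU (reindex (splitMem T Q) ψ)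
  have h1 := (h.tens_right (proj e)).conjBy (splitMem T Q)
  simp only [tens_proj, conjBy_proj] at h1
  simp only [initOp, conjBy_proj, swapState_eq, contract_adjoint_ket]
  exact h1

open Classical in
-- The matrix unit `|m₀⟩⟨m₁|` on finitely many variables is the product of the matrix units on the
-- single variables, so invariance can be checked one variable at a time.
theorem exists_mem_overwrite (K : ClosedSubmodule ℂ (Ell2 (Mem T))) (m₀ m₁ : Mem T)
    (F : Finset V)
    (hF : ∀ q ∈ F, ∀ ψ ∈ K, ∃ φ ∈ K, ∀ m, φ m =
      if m q = m₀ q then ψ (Function.update m q (m₁ q)) else 0) :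
    ∀ ψ ∈ K, ∃ φ ∈ K, ∀ m, φ m =
      if ∀ q ∈ F, m q = m₀ q then ψ (fun v => if v ∈ F then m₁ v else m v) else 0 := by
  induction F using Finset.induction_on with
  | empty => exact fun ψ hψ => ⟨ψ, hψ, fun m => by simp⟩
  | insert q F hq ih =>
    intro ψ hψ
    obtain ⟨φ, hφ, h⟩ := ih (fun q' hq' => hF q' (Finset.mem_insert_of_mem hq')) ψ hψ
    obtain ⟨χ, hχ, h'⟩ := hF q (Finset.mem_insert_self _ _) φ hφ
    refine ⟨χ, hχ, fun m => ?_⟩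
    have e1 : ∀ q' ∈ F, Function.update m q (m₁ q) q' = m q' := fun q' hq' =>
      Function.update_of_ne (fun h : q' = q => hq (h ▸ hq')) _ _
    have e2 : (fun v => if v ∈ F then m₁ v else Function.update m q (m₁ q) v)
        = fun v => if v ∈ insert q F then m₁ v else m v := by
      funext v
      by_cases hv : v = q
      · subst hv; simp [hq]
      · simp [hv]
    have e3 : (∀ q' ∈ F, Function.update m q (m₁ q) q' = m₀ q') ↔ ∀ q' ∈ F, m q' = m₀ q' :=
      forall₂_congr fun q' hq' => by rw [e1 q' hq']
    rw [h', h, e2]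
    by_cases hm : m q = m₀ q
    · rw [if_pos hm]
      refine if_congr (e3.trans ⟨fun h q' hq' => ?_, fun h q' hq' =>
        h q' (Finset.mem_insert_of_mem hq')⟩) rfl rfl
      obtain rfl | hq' := Finset.mem_insert.1 hq'
      exacts [hm, h q' hq']
    · rw [if_neg hm, if_neg fun h => hm (h q (Finset.mem_insert_self _ _))]

/-- A closed subspace invariant under all matrix units on `Q` is invariant under every bounded
operator on `Q`; finiteness of the list reduces matrix units on `Q` to those on single variables. -/
theorem liftOp_mem_of_update [Finite ι] [∀ v, Nonempty (T v)] (Q : ι ↪ V)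
    (K : ClosedSubmodule ℂ (Ell2 (Mem T)))
    (hQ : ∀ i, ∀ a b : T (Q i), ∀ ψ ∈ K, ∃ φ ∈ K, ∀ m, φ m =
      open Classical in if m (Q i) = a then ψ (Function.update m (Q i) b) else 0)
    (A : Ell2 (Vals T Q) →L[ℂ] Ell2 (Vals T Q)) {ψ : Ell2 (Mem T)} (hψ : ψ ∈ K) :
    liftOp T Q A ψ ∈ K := by
  classical
  have := Fintype.ofFinite ι
  let K' := K.comap ((reindex (splitMem T Q)).symm :
    Ell2 (Vals T Q × (∀ v : {v // v ∉ Set.range Q}, T v)) →L[ℂ] Ell2 (Mem T))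
  refine tensId_mem_of_ket K' (fun x x₀ => ?_) A
  change (reindex (splitMem T Q)).symm _ ∈ K
  -- Only used to extend `x` and `x₀` to full memories; its values outside `Q` do not enter.
  let m := Classical.arbitrary (Mem T)
  obtain ⟨φ, hφ, h⟩ := exists_mem_overwrite K (upd Q m x₀) (upd Q m x) (Finset.univ.map Q)
    (by
      intro q hq
      obtain ⟨i, -, rfl⟩ := Finset.mem_map.1 hq
      exact hQ i _ _) ψ hψ
  convert hφ using 1
  ext n
  rw [h, reindex_symm_apply, tvec_apply, ket_apply]
  have e1 : (∀ q ∈ Finset.univ.map Q, n q = upd Q m x₀ q) ↔ (splitMem T Q n).1 = x₀ := by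
    simp only [Finset.mem_map, Finset.mem_univ, true_and, forall_exists_index,
      forall_apply_eq_imp_iff, upd_apply]
    exact funext_iff.symm
  have e2 : (fun v => if v ∈ Finset.univ.map Q then upd Q m x v else n v) = upd Q n x := by
    refine eq_upd Q (fun i => ?_) fun v hv => ?_
    · rw [if_pos (Finset.mem_map_of_mem _ (Finset.mem_univ i)), upd_apply]
    · rw [if_neg]
      rintro hv'
      obtain ⟨i, -, rfl⟩ := Finset.mem_map.1 hv'
      exact hv ⟨i, rfl⟩
  simp only [e1, e2]
  split_ifs
  · rw [one_mul]; rfl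
  · rw [zero_mul]

/-- The matrix unit `|a⟩⟨b|` on a variable outside the support replaces each slice by another slice
of the same vector or by zero, so the slice criterion persists. -/
theorem exists_update_mem_tensTop {p : V → Prop} [DecidablePred p]
    (S : ClosedSubmodule ℂ (Ell2 (∀ v : {v // p v}, T v))) {q : V} (hq : ¬ p q) (a b : T q)
    {ψ : Ell2 (Mem T)} (hψ : ψ ∈ tensTop (Equiv.piEquivPiSubtypeProd p T) S.toSubmodule) :
    ∃ φ ∈ tensTop (Equiv.piEquivPiSubtypeProd p T) S.toSubmodule, ∀ m, φ m =
      open Classical in if m q = a then ψ (Function.update m q b) else 0 := by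
  classical
  let Q : Unit ↪ V := ⟨fun _ => q, fun _ _ _ => rfl⟩
  let φ : Ell2 (Mem T) := (reindex (splitMem T Q)).symm
    (tvec (ket fun _ => a) (sliceFst (fun _ => b) (reindex (splitMem T Q) ψ)))
  have hφ : ∀ m, φ m = if m q = a then ψ (Function.update m q b) else 0 := by
    intro m
    have e1 : Function.update m q b = upd Q m (fun _ => b) :=
      eq_upd Q (fun i => Function.update_self (f := m) q b) fun v hv =>
        Function.update_of_ne (fun h => hv ⟨(), h.symm⟩) _ _
    have e2 : (splitMem T Q m).1 = (fun _ => a) ↔ m q = a :=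
      ⟨fun h => congrFun h (), fun h => funext fun _ => h⟩
    change ket (fun _ => a) (splitMem T Q m).1 * ψ (upd Q m fun _ => b) = _
    rw [ket_apply, e1]
    simp only [e2, ite_mul, one_mul, zero_mul]
  refine ⟨φ, (mem_tensTop_iff _ _ _).2 fun y => ?_, hφ⟩
  rw [mem_tensTop_iff] at hψ
  let e := Equiv.piEquivPiSubtypeProd p T
  have h0 : ∀ x, e.symm (x, y) q = y ⟨q, hq⟩ := fun x => dif_neg hq
  by_cases hy : y ⟨q, hq⟩ = a
  · have e1 : ∀ x, Function.update (e.symm (x, y)) q b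
        = e.symm (x, Function.update y ⟨q, hq⟩ b) := by
      intro x
      funext v
      by_cases hv : v = q
      · subst hv
        simp [e, Equiv.piEquivPiSubtypeProd, hq]
      · by_cases hpv : p v
        · simp [e, Equiv.piEquivPiSubtypeProd, hv, hpv]
        · simp [e, Equiv.piEquivPiSubtypeProd, hv, hpv]
    have e2 : sliceSnd y (reindex e φ)
        = sliceSnd (Function.update y ⟨q, hq⟩ b) (reindex e ψ) := by
      ext x
      rw [sliceSnd_apply, reindex_apply, hφ, h0, if_pos hy, e1]
      rfl
    exact e2 ▸ hψ _
  · have e2 : sliceSnd y (reindex e φ) = 0 := by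
      ext x
      rw [sliceSnd_apply, reindex_apply, hφ, h0, if_neg hy]
      rfl
    exact e2 ▸ S.toSubmodule.zero_mem

end Lists

/-! ## Product structure forced by a quantum equality -/

theorem exists_apply_ne_zero {X : Type*} {ψ : Ell2 X} (h : ψ ≠ 0) : ∃ x, ψ x ≠ 0 := by
  by_contra! h0
  exact h (by ext x; exact h0 x)

theorem eq_smul_of_tvec_eq {X Y : Type*} {a p : Ell2 X} {b q : Ell2 Y}
    (h : tvec a b = tvec p q) {y : Y} (hy : b y ≠ 0) : a = (q y / b y) • p := by
  have h1 := congrArg (sliceSnd y) h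
  rw [sliceSnd_tvec, sliceSnd_tvec] at h1
  rw [div_eq_inv_mul, mul_smul, ← h1, smul_smul, inv_mul_cancel₀ hy, one_smul]

theorem eq_smul_of_tvec_eq' {X Y : Type*} {a p : Ell2 X} {b q : Ell2 Y}
    (h : tvec a b = tvec p q) {x : X} (hx : a x ≠ 0) : b = (p x / a x) • q := by
  have h1 := congrArg (sliceFst x) h
  rw [sliceFst_tvec, sliceFst_tvec] at h1
  rw [div_eq_inv_mul, mul_smul, ← h1, smul_smul, inv_mul_cancel₀ hx, one_smul]

theorem exists_sliceSnd_ne_zero {X Y : Type*} {ψ : Ell2 (X × Y)} (h : ψ ≠ 0) :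
    ∃ y, sliceSnd y ψ ≠ 0 := by
  by_contra! h0
  refine h ?_
  ext p
  exact congrArg (fun χ : Ell2 X => χ p.1) (h0 p.2)

theorem exists_eq_tvec {X Y : Type*} {ψ : Ell2 (X × Y)} {u : Ell2 X} (hu : u ≠ 0)
    (h : ∀ y, ∃ c : ℂ, sliceSnd y ψ = c • u) : ∃ G : Ell2 Y, ψ = tvec u G := by
  obtain ⟨x₀, hx₀⟩ := exists_apply_ne_zero hu
  refine ⟨(u x₀)⁻¹ • sliceFst x₀ ψ, ?_⟩
  ext ⟨x, y⟩
  obtain ⟨c, hc⟩ := h y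
  have h1 : ∀ x, ψ (x, y) = c * u x := fun x => congrArg (fun χ : Ell2 X => χ x) hc
  change ψ (x, y) = u x * ((u x₀)⁻¹ * ψ (x₀, y))
  rw [h1, h1]
  field_simp

theorem norm_adjoint_apply_le {X Y : Type*} {A : Ell2 X →L[ℂ] Ell2 Y} (hA : ∀ ψ, ‖A ψ‖ = ‖ψ‖)
    (φ : Ell2 Y) : ‖A.adjoint φ‖ ≤ ‖φ‖ := by
  have h1 : ‖A‖ ≤ 1 := A.opNorm_le_bound zero_le_one fun ψ => by rw [hA, one_mul]
  refine (A.adjoint.le_opNorm φ).trans ?_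
  rw [LinearIsometryEquiv.norm_map]
  exact mul_le_of_le_one_left (norm_nonneg _) h1

/-- Fix nonzero slices `a`, `b`. Holding `b` fixed, the equation makes every slice of `ψ` a multiple
of `p = A*A'b`; holding `a` fixed, every slice of `φ` is a multiple of `b`. Hence both vectors
factor. A norm comparison then gives `‖A*A'b‖ = ‖A'b‖`, and equality here forces `A p = A' b`. -/
theorem exists_product_of_tvec_eq {X X' Y Y' S : Type*} {A : Ell2 X →L[ℂ] Ell2 S}
    {A' : Ell2 X' →L[ℂ] Ell2 S} (hA : ∀ ψ, ‖A ψ‖ = ‖ψ‖) (hA' : ∀ ψ, ‖A' ψ‖ = ‖ψ‖)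
    {ψ : Ell2 (X × Y)} {φ : Ell2 (X' × Y')} (hψ : ψ ≠ 0) (hφ : φ ≠ 0)
    (h : ∀ y y', tvec (sliceSnd y ψ) (sliceSnd y' φ) =
      tvec (A.adjoint (A' (sliceSnd y' φ))) (A'.adjoint (A (sliceSnd y ψ)))) :
    ∃ u G u' G', ψ = tvec u G ∧ φ = tvec u' G' ∧ A u = A' u' := by
  obtain ⟨y, hy⟩ := exists_sliceSnd_ne_zero hψ
  obtain ⟨y', hy'⟩ := exists_sliceSnd_ne_zero hφ
  set a := sliceSnd y ψ with ha
  set b := sliceSnd y' φ with hb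
  set p := A.adjoint (A' b) with hp
  set q := A'.adjoint (A a) with hq
  obtain ⟨x, hx⟩ := exists_apply_ne_zero hy
  obtain ⟨x', hx'⟩ := exists_apply_ne_zero hy'
  have e0 : tvec a b = tvec p q := h y y'
  have ea := eq_smul_of_tvec_eq e0 hx'
  have eb := eq_smul_of_tvec_eq' e0 hx
  set c := q x' / b x'
  set d := p x / a x
  have hp0 : p ≠ 0 := fun h0 => hy (by rw [ea, h0, smul_zero])
  have hq0 : q ≠ 0 := fun h0 => hy' (by rw [eb, h0, smul_zero])
  have hd0 : d ≠ 0 := fun h0 => hy' (by rw [eb, h0, zero_smul])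
  -- Here `a = c p` and `b = d q`, while `a ⊗ b = p ⊗ q` is nonzero.
  have hcd : ‖c‖ * ‖d‖ = 1 := by
    have h1 := congrArg norm e0
    rw [norm_tvec, norm_tvec, ea, eb, norm_smul, norm_smul] at h1
    have h2 : ‖p‖ * ‖q‖ ≠ 0 := mul_ne_zero (norm_ne_zero_iff.2 hp0) (norm_ne_zero_iff.2 hq0)
    refine mul_right_cancel₀ h2 ?_
    linear_combination h1
  obtain ⟨G, hG⟩ := exists_eq_tvec hp0 fun y₁ => ⟨_, eq_smul_of_tvec_eq (h y₁ y') hx'⟩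
  obtain ⟨G', hG'⟩ := exists_eq_tvec (ψ := φ) hy' fun y₁ => by
    refine ⟨(A.adjoint (A' (sliceSnd y₁ φ)) x / a x) * d⁻¹, ?_⟩
    rw [eb, smul_smul, mul_assoc, inv_mul_cancel₀ hd0, mul_one]
    exact eq_smul_of_tvec_eq' (h y y₁) hx
  refine ⟨p, G, b, G', hG, hG', ?_⟩
  have n1 : ‖p‖ ≤ ‖b‖ := (norm_adjoint_apply_le hA _).trans (hA' b).le
  have n2 : ‖b‖ ≤ ‖p‖ := by
    calc ‖b‖ = ‖d‖ * ‖q‖ := by rw [eb, norm_smul]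
      _ ≤ ‖d‖ * ‖a‖ := by
        gcongr
        exact (norm_adjoint_apply_le hA' _).trans (hA a).le
      _ = ‖c‖ * ‖d‖ * ‖p‖ := by rw [ea, norm_smul]; ring
      _ = ‖p‖ := by rw [hcd, one_mul]
  have n3 : ‖b‖ = ‖p‖ := le_antisymm n2 n1
  -- Expanding `‖A p - A' b‖²`, the cross term is `⟪p, A*A'b⟫ = ‖p‖²`, so everything cancels.
  rw [← sub_eq_zero, ← norm_eq_zero, ← sq_eq_zero_iff, norm_sub_sq (𝕜 := ℂ), hA, hA', n3,
    ← ContinuousLinearMap.adjoint_inner_right, ← hp, inner_self_eq_norm_sq]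
  ring

/-! ## Pairs of memories -/

section Pairs

variable {CV QV : Type*} {TC : CV → Type*} {TQ : QV → Type*}

theorem pairMem_upd_one {ι : Type*} (Q : ι ↪ QV) (m : Mem (Idx TQ)) (x : Vals TQ Q) :
    pairMem TQ (upd (T := Idx TQ) (at' Q Side.one) m x)
      = (upd Q (pairMem TQ m).1 x, (pairMem TQ m).2) := by
  refine Prod.ext (eq_upd Q (fun i => ?_) fun v hv => ?_) (funext fun v => ?_)
  · exact upd_apply (T := Idx TQ) (at' Q Side.one) m x i
  · exact upd_of_notMem (T := Idx TQ) (at' Q Side.one) m x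
      (by rintro ⟨i, hi⟩; exact hv ⟨i, (Prod.mk.inj hi).1⟩)
  · exact upd_of_notMem (T := Idx TQ) (at' Q Side.one) m x
      (by rintro ⟨i, hi⟩; exact Side.noConfusion (Prod.mk.inj hi).2)

theorem pairMem_upd_two {ι : Type*} (Q : ι ↪ QV) (m : Mem (Idx TQ)) (x : Vals TQ Q) :
    pairMem TQ (upd (T := Idx TQ) (at' Q Side.two) m x)
      = ((pairMem TQ m).1, upd Q (pairMem TQ m).2 x) := by
  refine Prod.ext (funext fun v => ?_) (eq_upd Q (fun i => ?_) fun v hv => ?_)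
  · exact upd_of_notMem (T := Idx TQ) (at' Q Side.two) m x
      (by rintro ⟨i, hi⟩; exact Side.noConfusion (Prod.mk.inj hi).2)
  · exact upd_apply (T := Idx TQ) (at' Q Side.two) m x i
  · exact upd_of_notMem (T := Idx TQ) (at' Q Side.two) m x
      (by rintro ⟨i, hi⟩; exact hv ⟨i, (Prod.mk.inj hi).1⟩)

theorem pairMem_upd_append12 {ι κ : Type*} (Q : ι ↪ QV) (R : κ ↪ QV) (m : Mem (Idx TQ))
    (x : Vals (Idx TQ) (append12 Q R)) :
    pairMem TQ (upd (append12 Q R) m x)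
      = (upd Q (pairMem TQ m).1 (valsAppend12 TQ Q R x).1,
        upd R (pairMem TQ m).2 (valsAppend12 TQ Q R x).2) := by
  refine Prod.ext (eq_upd Q (fun i => ?_) fun v hv => ?_) (eq_upd R (fun i => ?_) fun v hv => ?_)
  · exact upd_apply (append12 Q R) m x (Sum.inl i)
  · refine upd_of_notMem (append12 Q R) m x ?_
    rintro ⟨i | i, hi⟩
    · exact hv ⟨i, (Prod.mk.inj hi).1⟩
    · exact Side.noConfusion (Prod.mk.inj hi).2
  · exact upd_apply (append12 Q R) m x (Sum.inr i)
  · refine upd_of_notMem (append12 Q R) m x ?_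
    rintro ⟨i | i, hi⟩
    · exact Side.noConfusion (Prod.mk.inj hi).2
    · exact hv ⟨i, (Prod.mk.inj hi).1⟩

theorem pairVec_swapState_left {ι : Type*} (Q : ι ↪ QV) (e w : Ell2 (Vals TQ Q))
    (ψ φ : Ell2 (Mem TQ)) :
    pairVec (swapState Q e w ψ) φ
      = swapState (T := Idx TQ) (at' Q Side.one) e w (pairVec ψ φ) := by
  ext m
  let a : Ell2 (Vals TQ Q) := sl (T := Idx TQ) (at' Q Side.one) (pairVec ψ φ) m
  have h : a = φ (pairMem TQ m).2 • sl Q ψ (pairMem TQ m).1 := by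
    ext x
    exact (congrArg (fun p : Mem TQ × Mem TQ => ψ p.1 * φ p.2) (pairMem_upd_one Q m x)).trans
      (mul_comm _ _)
  change ⟪w, sl Q ψ (pairMem TQ m).1⟫_ℂ * e (fun i => m (Q i, Side.one)) * φ (pairMem TQ m).2
    = ⟪w, a⟫_ℂ * e (fun i => m (Q i, Side.one))
  rw [h, inner_smul_right]
  ring

theorem pairVec_swapState_right {ι : Type*} (Q : ι ↪ QV) (e w : Ell2 (Vals TQ Q))
    (ψ φ : Ell2 (Mem TQ)) :
    pairVec ψ (swapState Q e w φ)
      = swapState (T := Idx TQ) (at' Q Side.two) e w (pairVec ψ φ) := by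
  ext m
  let a : Ell2 (Vals TQ Q) := sl (T := Idx TQ) (at' Q Side.two) (pairVec ψ φ) m
  have h : a = ψ (pairMem TQ m).1 • sl Q φ (pairMem TQ m).2 := by
    ext x
    exact congrArg (fun p : Mem TQ × Mem TQ => ψ p.1 * φ p.2) (pairMem_upd_two Q m x)
  change ψ (pairMem TQ m).1 * (⟪w, sl Q φ (pairMem TQ m).2⟫_ℂ * e (fun i => m (Q i, Side.two)))
    = ⟪w, a⟫_ℂ * e (fun i => m (Q i, Side.two))
  rw [h, inner_smul_right]
  ring

theorem sl_append12_pairVec {ι κ : Type*} (Q : ι ↪ QV) (R : κ ↪ QV) (ψ φ : Ell2 (Mem TQ))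
    (m : Mem (Idx TQ)) :
    reindex (valsAppend12 TQ Q R) (sl (append12 Q R) (pairVec ψ φ) m)
      = tvec (sl Q ψ (pairMem TQ m).1) (sl R φ (pairMem TQ m).2) := by
  ext x
  rw [reindex_apply, sl_apply, pairVec_apply, pairMem_upd_append12, Equiv.apply_symm_apply]
  rfl

/-- On a product state each slice along `Q₁ R₂` is a product of slices, which the twisted swap maps
to a product again. -/
theorem mem_quantEq_pairVec {ι κ Z : Type*} (Q : ι ↪ QV) (R : κ ↪ QV)
    (U : Mem (Idx TC) → Ell2 (Vals TQ Q) →L[ℂ] Ell2 Z)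
    (V : Mem (Idx TC) → Ell2 (Vals TQ R) →L[ℂ] Ell2 Z) (m : Mem (Idx TC))
    (ψ φ : Ell2 (Mem TQ)) :
    pairVec ψ φ ∈ quantEq Q R U V m ↔ ∀ m₁ m₂, tvec (sl Q ψ m₁) (sl R φ m₂) =
      tvec ((U m).adjoint (V m (sl R φ m₂))) ((V m).adjoint (U m (sl Q ψ m₁))) := by
  have key : ∀ n : Mem (Idx TQ), liftOp (Idx TQ) (append12 Q R) (conjBy (valsAppend12 TQ Q R)
      ((reindex (Equiv.prodComm (Vals TQ R) (Vals TQ Q)) :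
        Ell2 (Vals TQ R × Vals TQ Q) →L[ℂ] Ell2 (Vals TQ Q × Vals TQ R)) ∘L
      tens ((V m).adjoint ∘L U m) ((U m).adjoint ∘L V m))) (pairVec ψ φ) n
      = (U m).adjoint (V m (sl R φ (pairMem TQ n).2)) (fun i => (pairMem TQ n).1 (Q i))
        * (V m).adjoint (U m (sl Q ψ (pairMem TQ n).1)) (fun i => (pairMem TQ n).2 (R i)) := by
    intro n
    rw [liftOp_apply, conjBy_apply, sl_append12_pairVec, ContinuousLinearMap.comp_apply, tens_tvec]
    exact mul_comm _ _
  rw [quantEq, mem_fixedSpace]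
  constructor
  · intro h m₁ m₂
    ext ⟨x, y⟩
    have h1 := key ((pairMem TQ).symm (upd Q m₁ x, upd R m₂ y))
    rw [h, pairVec_apply, Equiv.apply_symm_apply] at h1
    simp only [sl_upd, upd_apply] at h1
    exact h1
  · intro h
    ext n
    rw [key, pairVec_apply]
    have h1 := congrArg (fun χ : Ell2 (Vals TQ Q × Vals TQ R) =>
      χ (fun i => (pairMem TQ n).1 (Q i), fun i => (pairMem TQ n).2 (R i)))
      (h (pairMem TQ n).1 (pairMem TQ n).2)
    simp only [tvec_apply, sl_apply_self] at h1
    exact h1.symm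

/-- Each variable of `Q` is missed by some set `S` over which `B` is a predicate, where `S` may vary
with the variable. Treating the variables one by one avoids having to show that `B` is a predicate
over `fv B` itself. -/
theorem liftOp_mem_of_disjoint_fv {ι : Type*} [Finite ι] [∀ q, Nonempty (TQ q)] (Q : ι ↪ QV)
    (s : Side) {B : QPred TC TQ} (hB : Disjoint (fv B) (varsOf Q s)) (m : Mem (Idx TC))
    (A : Ell2 (Vals (Idx TQ) (at' Q s)) →L[ℂ] Ell2 (Vals (Idx TQ) (at' Q s)))
    {ψ : Ell2 (Mem (Idx TQ))} (hψ : ψ ∈ B m) : liftOp (Idx TQ) (at' Q s) A ψ ∈ B m := by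
  classical
  refine liftOp_mem_of_update (at' Q s) (B m) (fun i a b χ hχ => ?_) A hψ
  have h1 : (Sum.inr (at' Q s i) : (CV × Side) ⊕ (QV × Side)) ∉ fv B := fun h =>
    Set.disjoint_left.1 hB h ⟨i, rfl⟩
  simp only [fv, Set.mem_sInter, not_forall] at h1
  obtain ⟨S, hS, hi⟩ := h1
  obtain ⟨A', hA'⟩ := hS.2 m
  rw [hA'] at hχ ⊢
  exact exists_update_mem_tensTop A' hi a b hχ

/-! ## Initialization on product states -/

/-- The operator `id ⊗ ⟨z|U` on the variables `R Q`. -/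
def discard {κ ι Z : Type*} (R : κ ↪ QV) (Q : ι ↪ QV) (h : ∀ i j, R i ≠ Q j)
    (U : Ell2 (Vals TQ Q) →L[ℂ] Ell2 Z) (z : Z) (u : Ell2 (Vals TQ (append R Q h))) :
    Ell2 (Vals TQ R) :=
  sliceFst z (tensId U _ (reindex (Equiv.prodComm _ _) (reindex (valsAppend TQ R Q h) u)))

theorem sliceSnd_tensAppend {κ ι W Z : Type*} (R : κ ↪ QV) (Q : ι ↪ QV) (h : ∀ i j, R i ≠ Q j)
    (V : Ell2 (Vals TQ R) →L[ℂ] Ell2 W) (U : Ell2 (Vals TQ Q) →L[ℂ] Ell2 Z) (z : Z)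
    (u : Ell2 (Vals TQ (append R Q h))) :
    sliceSnd z (tensAppend R Q h V U u) = V (discard R Q h U z u) := rfl

/-- The effect of reinitializing `Q` on a state in which `R Q` is not entangled with the rest. -/
theorem swapState_apply_of_product {κ ι Z : Type*} {R : κ ↪ QV} {Q : ι ↪ QV}
    {h : ∀ i j, R i ≠ Q j} (U : Ell2 (Vals TQ Q) →L[ℂ] Ell2 Z) (e : Ell2 (Vals TQ Q)) (z : Z)
    {ψ : Ell2 (Mem TQ)} {u : Ell2 (Vals TQ (append R Q h))} {G}
    (hψ : reindex (splitMem TQ (append R Q h)) ψ = tvec u G) (m : Mem TQ) :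
    swapState Q e (U.adjoint (ket z)) ψ m
      = discard R Q h U z u (fun i => m (R i)) * e (fun i => m (Q i))
        * G (splitMem TQ (append R Q h) m).2 := by
  have h1 : sl Q ψ m = G (splitMem TQ (append R Q h) m).2 •
      sliceFst (fun i => m (R i)) (reindex (valsAppend TQ R Q h) u) := by
    ext x
    have h2 := congrArg (fun χ : Ell2 (_ × _) => χ (splitMem TQ (append R Q h) (upd Q m x))) hψ
    simp only [reindex_apply, Equiv.symm_apply_apply, tvec_apply] at h2
    rw [sl_apply, h2, mul_comm]
    have e1 : (splitMem TQ (append R Q h) (upd Q m x)).2 = (splitMem TQ (append R Q h) m).2 := by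
      funext v
      refine upd_of_notMem Q m x fun hv => v.2 ?_
      obtain ⟨i, hi⟩ := hv
      exact ⟨Sum.inr i, hi⟩
    have e2 : (splitMem TQ (append R Q h) (upd Q m x)).1
        = (valsAppend TQ R Q h).symm (fun i => m (R i), x) := by
      funext i
      obtain i | i := i
      · refine upd_of_notMem Q m x ?_
        rintro ⟨j, hj⟩
        exact h i j hj.symm
      · exact upd_apply Q m x i
    rw [e1, e2]
    rfl
  rw [swapState_apply, h1, ContinuousLinearMap.adjoint_inner_left, inner_ket_left, map_smul]
  change G _ * discard R Q h U z u (fun i => m (R i)) * e (fun i => m (Q i)) = _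
  ring

theorem norm_swapState_of_product {κ ι Z : Type*} {R : κ ↪ QV} {Q : ι ↪ QV}
    {h : ∀ i j, R i ≠ Q j} (U : Ell2 (Vals TQ Q) →L[ℂ] Ell2 Z) (e : Ell2 (Vals TQ Q)) (z : Z)
    {ψ : Ell2 (Mem TQ)} {u : Ell2 (Vals TQ (append R Q h))} {G}
    (hψ : reindex (splitMem TQ (append R Q h)) ψ = tvec u G) :
    ‖swapState Q e (U.adjoint (ket z)) ψ‖ = ‖discard R Q h U z u‖ * ‖e‖ * ‖G‖ := by
  have : swapState Q e (U.adjoint (ket z)) ψ = (reindex (splitMem TQ (append R Q h))).symm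
      (tvec ((reindex (valsAppend TQ R Q h)).symm (tvec (discard R Q h U z u) e)) G) := by
    ext m
    exact swapState_apply_of_product U e z hψ m
  rw [this, LinearIsometryEquiv.norm_map, norm_tvec, LinearIsometryEquiv.norm_map, norm_tvec]

/-- After reinitialization the state is a product of the leftover of `u` on `R`, of `e` on `Q`, and
of `G`; hence every slice along `R` is proportional to that leftover. -/
theorem sl_swapState_of_product {κ ι Z : Type*} {R : κ ↪ QV} {Q : ι ↪ QV}
    {h : ∀ i j, R i ≠ Q j} (U : Ell2 (Vals TQ Q) →L[ℂ] Ell2 Z) (e : Ell2 (Vals TQ Q)) (z : Z)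
    {ψ : Ell2 (Mem TQ)} {u : Ell2 (Vals TQ (append R Q h))} {G}
    (hψ : reindex (splitMem TQ (append R Q h)) ψ = tvec u G) (m : Mem TQ) :
    ∃ c : ℂ, sl R (swapState Q e (U.adjoint (ket z)) ψ) m = c • discard R Q h U z u := by
  refine ⟨e (fun i => m (Q i)) * G (splitMem TQ (append R Q h) m).2, ?_⟩
  ext x
  rw [sl_apply, swapState_apply_of_product U e z hψ]
  have e1 : (splitMem TQ (append R Q h) (upd R m x)).2 = (splitMem TQ (append R Q h) m).2 := by
    funext v
    refine upd_of_notMem R m x fun hv => v.2 ?_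
    obtain ⟨i, hi⟩ := hv
    exact ⟨Sum.inl i, hi⟩
  have e2 : (fun i => upd R m x (Q i)) = fun i => m (Q i) := by
    funext i
    refine upd_of_notMem R m x ?_
    rintro ⟨j, hj⟩
    exact h j i hj
  have e3 : (fun i => upd R m x (R i)) = x := funext fun i => upd_apply R m x i
  rw [e1, e2, e3]
  change _ = e (fun i => m (Q i)) * G (splitMem TQ (append R Q h) m).2 * discard R Q h U z u x
  ring

theorem norm_tensAppend {κ ι W Z : Type*} (R : κ ↪ QV) (Q : ι ↪ QV) (h : ∀ i j, R i ≠ Q j)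
    {V : Ell2 (Vals TQ R) →L[ℂ] Ell2 W} {U : Ell2 (Vals TQ Q) →L[ℂ] Ell2 Z}
    (hV : ∀ ψ, ‖V ψ‖ = ‖ψ‖) (hU : ∀ ψ, ‖U ψ‖ = ‖ψ‖) (u : Ell2 (Vals TQ (append R Q h))) :
    ‖tensAppend R Q h V U u‖ = ‖u‖ :=
  (norm_tens_apply hV hU _).trans (LinearIsometryEquiv.norm_map _ _)

theorem adjoint_apply_self {X Y : Type*} {A : Ell2 X →L[ℂ] Ell2 Y} (hA : ∀ ψ, ‖A ψ‖ = ‖ψ‖)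
    (ψ : Ell2 X) : A.adjoint (A ψ) = ψ := by
  refine ext_inner_left ℂ fun φ => ?_
  rw [ContinuousLinearMap.adjoint_inner_right]
  exact (LinearMap.norm_map_iff_inner_map_map A).1 hA φ ψ

theorem sl_splitMem_symm {V ι : Type*} {T : V → Type*} (Q : ι ↪ V) (ψ : Ell2 (Mem T))
    (x : Vals T Q) (y : ∀ v : {v // v ∉ Set.range Q}, T v) :
    sl Q ψ ((splitMem T Q).symm (x, y)) = sliceSnd y (reindex (splitMem T Q) ψ) := by
  rw [sl, Equiv.apply_symm_apply]

/-- Discarding `Q` and `Q'` by measuring them in the same basis preserves quantum equality of the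
remaining variables and the probabilities of the outcomes. -/
theorem swapState_quantEq {κ ι κ' ι' W Z : Type*} (R : κ ↪ QV) (Q : ι ↪ QV) (R' : κ' ↪ QV)
    (Q' : ι' ↪ QV) (hRQ : ∀ i j, R i ≠ Q j) (hRQ' : ∀ i j, R' i ≠ Q' j)
    {e : Ell2 (Vals TQ Q)} (he : ‖e‖ = 1) {e' : Ell2 (Vals TQ Q')} (he' : ‖e'‖ = 1)
    (V : Mem (Idx TC) → Ell2 (Vals TQ R) →L[ℂ] Ell2 W)
    (U : Mem (Idx TC) → Ell2 (Vals TQ Q) →L[ℂ] Ell2 Z)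
    (V' : Mem (Idx TC) → Ell2 (Vals TQ R') →L[ℂ] Ell2 W)
    (U' : Mem (Idx TC) → Ell2 (Vals TQ Q') →L[ℂ] Ell2 Z) (m : Mem (Idx TC))
    (hU : ∀ ψ, ‖U m ψ‖ = ‖ψ‖) (hU' : ∀ ψ, ‖U' m ψ‖ = ‖ψ‖) (hV : ∀ ψ, ‖V m ψ‖ = ‖ψ‖)
    (hV' : ∀ ψ, ‖V' m ψ‖ = ‖ψ‖) {ψ φ : Ell2 (Mem TQ)} (hψ : ψ ≠ 0) (hφ : φ ≠ 0)
    (h : pairVec ψ φ ∈ quantEq (append R Q hRQ) (append R' Q' hRQ')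
              (fun m => tensAppend R Q hRQ (V m) (U m))
              (fun m => tensAppend R' Q' hRQ' (V' m) (U' m)) m) (z : Z) :
    pairVec (swapState Q e ((U m).adjoint (ket z)) ψ) (swapState Q' e' ((U' m).adjoint (ket z)) φ)
        ∈ quantEq R R' V V' m ∧
      ‖swapState Q e ((U m).adjoint (ket z)) ψ‖ * ‖φ‖
        = ‖ψ‖ * ‖swapState Q' e' ((U' m).adjoint (ket z)) φ‖ := by
  rw [mem_quantEq_pairVec] at h
  have hA := norm_tensAppend R Q hRQ hV hU
  have hA' := norm_tensAppend R' Q' hRQ' hV' hU'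
  obtain ⟨u, G, u', G', h1, h2, h3⟩ := exists_product_of_tvec_eq hA hA'
    (ψ := reindex (splitMem TQ (append R Q hRQ)) ψ)
    (φ := reindex (splitMem TQ (append R' Q' hRQ')) φ)
    (by simpa using hψ) (by simpa using hφ) (fun y y' => by
      ext p
      have h1 := h ((splitMem TQ (append R Q hRQ)).symm (p.1, y))
        ((splitMem TQ (append R' Q' hRQ')).symm (p.2, y'))
      rw [sl_splitMem_symm, sl_splitMem_symm] at h1
      rw [h1])
  -- Apply `id ⊗ ⟨z|` to `A u = A' u'`.
  have h4 : V m (discard R Q hRQ (U m) z u) = V' m (discard R' Q' hRQ' (U' m) z u') := by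
    rw [← sliceSnd_tensAppend, ← sliceSnd_tensAppend, h3]
  constructor
  · rw [mem_quantEq_pairVec]
    intro m₁ m₂
    obtain ⟨c, hc⟩ := sl_swapState_of_product (U m) e z h1 m₁
    obtain ⟨c', hc'⟩ := sl_swapState_of_product (U' m) e' z h2 m₂
    rw [hc, hc']
    simp only [map_smul]
    rw [h4, adjoint_apply_self hV', ← h4, adjoint_apply_self hV]
    ext p
    change c * _ * (c' * _) = c' * _ * (c * _)
    ring
  · have n1 := norm_swapState_of_product (U m) e z h1
    have n2 := norm_swapState_of_product (U' m) e' z h2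
    have n3 : ‖ψ‖ = ‖u‖ * ‖G‖ := by
      rw [← norm_tvec, ← h1, LinearIsometryEquiv.norm_map]
    have n4 : ‖φ‖ = ‖u'‖ * ‖G'‖ := by
      rw [← norm_tvec, ← h2, LinearIsometryEquiv.norm_map]
    have n5 : ‖u‖ = ‖u'‖ := by rw [← hA, ← hA', h3]
    have n6 : ‖discard R Q hRQ (U m) z u‖ = ‖discard R' Q' hRQ' (U' m) z u'‖ := by
      rw [← hV, ← hV', h4]
    rw [n1, n2, n3, n4, n5, n6, he, he']
    ring

end Pairs

/-! ### Coupling equal outcomes and the two rules. -/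

section Judgments

variable {CV QV : Type*} {TC : CV → Type*} {TQ : QV → Type*}

theorem initOp_proj_zero {V ι : Type*} {T : V → Type*} (Q : ι ↪ V) (e : Ell2 (Vals T Q)) :
    initOp Q e (proj 0) = 0 := by
  refine (hasSum_initOp_proj Q e (U := .id ℂ _) (fun _ => rfl) 0).unique ?_
  simp only [map_zero, proj_zero]
  exact hasSum_zero

theorem IsMix.initDenot {I Z ι : Type*} (Q : ι ↪ QV) (e : Mem TC → Ell2 (Vals TQ Q))
    {ρ : CQ1 TC TQ} {n : I → Mem TC} {χ : I → Ell2 (Mem TQ)} (h : IsMix ρ n χ)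
    {ξ : I → Z → Ell2 (Mem TQ)}
    (hξ : ∀ i, HasSum (fun z => proj (ξ i z)) (initOp Q (e (n i)) (proj (χ i))))
    (hs : Summable fun p : I × Z => ‖ξ p.1 p.2‖ ^ 2) :
    IsMix (initDenot Q e ρ) (fun p : I × Z => n p.1) fun p => ξ p.1 p.2 := by
  refine ⟨hs, fun m => ?_⟩
  have h1 := (summable_proj (summable_norm_sq_loc (n := fun p : I × Z => n p.1) hs m)).of_norm
  have h2 : HasSum (fun i => initOp Q (e m) (proj (loc (n i) (χ i) m)))
      (_root_.initDenot Q e ρ m) :=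
    hasSum_initOp Q (e m) (summable_norm_sq_loc h.1 m) (h.2 m)
  have h3 := HasSum.prod_fiberwise (f := fun p : I × Z => proj (loc (n p.1) (ξ p.1 p.2) m))
    h1.hasSum (g := fun i => initOp Q (e m) (proj (loc (n i) (χ i) m)))
    fun i => by
      by_cases hi : n i = m
      · simp only [← hi, loc_self]
        exact hξ i
      · simp only [loc_of_ne hi, proj_zero]
        have h4 := initOp_proj_zero Q (e m)
        rw [proj_zero] at h4
        rw [h4]
        exact hasSum_zero
  rw [h2.unique h3]
  exact h1.hasSum

theorem norm_apply_of_isometry {X Y : Type*} {U : Ell2 X →L[ℂ] Ell2 Y} (hU : Isometry U)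
    (ψ : Ell2 X) : ‖U ψ‖ = ‖ψ‖ :=
  (AddMonoidHomClass.isometry_iff_norm U).1 hU ψ

/-- Both sides are measured and the same outcome `z` is paired with itself. The outcome weights
agree relative to `‖ψ‖²` and `‖φ‖²`, so one rescaling per outcome fixes both marginals at once. -/
theorem exists_init_coupling {κ ι κ' ι' W Z : Type*} [Finite ι] [Finite ι']
    [∀ q, Nonempty (TQ q)] (R : κ ↪ QV) (Q : ι ↪ QV)
    (R' : κ' ↪ QV) (Q' : ι' ↪ QV) (hRQ : ∀ i j, R i ≠ Q j) (hRQ' : ∀ i j, R' i ≠ Q' j)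
    {e : Mem TC → Ell2 (Vals TQ Q)} (he : ∀ m, ‖e m‖ = 1)
    {e' : Mem TC → Ell2 (Vals TQ Q')} (he' : ∀ m, ‖e' m‖ = 1)
    {B : QPred TC TQ} (hB : Disjoint (fv B) (varsOf Q Side.one ∪ varsOf Q' Side.two))
    (V : Mem (Idx TC) → Ell2 (Vals TQ R) →L[ℂ] Ell2 W)
    (U : Mem (Idx TC) → Ell2 (Vals TQ Q) →L[ℂ] Ell2 Z)
    (V' : Mem (Idx TC) → Ell2 (Vals TQ R') →L[ℂ] Ell2 W)
    (U' : Mem (Idx TC) → Ell2 (Vals TQ Q') →L[ℂ] Ell2 Z) (m₁ m₂ : Mem TC)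
    (ψ φ : Ell2 (Mem TQ))
    (h : pairVec ψ φ ∈ (B ⊓ quantEq (append R Q hRQ) (append R' Q' hRQ')
              (fun m => tensAppend R Q hRQ (V m) (U m))
              (fun m => tensAppend R' Q' hRQ' (V' m) (U' m))
          ⊓ Cl fun m => Isometry (U m) ∧ Isometry (U' m) ∧ Isometry (V m) ∧ Isometry (V' m))
            (pairC m₁ m₂)) :
    ∃ α β : Z → Ell2 (Mem TQ),
      HasSum (fun z => ‖pairVec (α z) (β z)‖ ^ 2) (‖pairVec ψ φ‖ ^ 2) ∧
      HasSum (fun z => proj ((‖β z‖ : ℂ) • α z)) (initOp Q (e m₁) (proj ((‖φ‖ : ℂ) • ψ))) ∧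
      HasSum (fun z => proj ((‖α z‖ : ℂ) • β z)) (initOp Q' (e' m₂) (proj ((‖ψ‖ : ℂ) • φ))) ∧
      ∀ z, pairVec (α z) (β z) ∈ (B ⊓ quantEq R R' V V' ⊓ spanAt Q Side.one e
        ⊓ spanAt Q' Side.two e') (pairC m₁ m₂) := by
  obtain ⟨⟨hBm, hq⟩, hCl⟩ := h
  -- The zero vector lies in every predicate, even where the operators are not isometries, so it is
  -- treated apart with the zero coupling.
  by_cases h0 : ψ = 0 ∨ φ = 0
  · refine ⟨0, 0, ?_, ?_, ?_, fun z => ?_⟩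
    · have : pairVec ψ φ = 0 := by
        rcases h0 with rfl | rfl
        · exact pairVec_zero_left _
        · exact pairVec_zero_right _
      simp [this, pairVec_zero_left]
    · have : (‖φ‖ : ℂ) • ψ = 0 := by rcases h0 with rfl | rfl <;> simp
      rw [this, initOp_proj_zero]
      simp
    · have : (‖ψ‖ : ℂ) • φ = 0 := by rcases h0 with rfl | rfl <;> simp
      rw [this, initOp_proj_zero]
      simp
    · rw [Pi.zero_apply, pairVec_zero_left]
      exact ClosedSubmodule.toSubmodule _ |>.zero_mem
  obtain ⟨hψ, hφ⟩ := not_or.1 h0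
  set m := pairC m₁ m₂
  have hiso : Isometry (U m) ∧ Isometry (U' m) ∧ Isometry (V m) ∧ Isometry (V' m) := by
    by_contra hn
    have h1 : pairVec ψ φ ∈ (⊥ : ClosedSubmodule ℂ (Ell2 (Mem (Idx TQ)))) := by
      have := hCl
      rwa [Cl, if_neg hn] at this
    have h2 : ‖pairVec ψ φ‖ = 0 := norm_eq_zero.2 h1
    rw [norm_pairVec] at h2
    simp [hψ, hφ] at h2
  have hU := norm_apply_of_isometry hiso.1
  have hU' := norm_apply_of_isometry hiso.2.1
  have key := swapState_quantEq R Q R' Q' hRQ hRQ' (he m₁) (he' m₂) V U V' U' m hU hU'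
    (norm_apply_of_isometry hiso.2.2.1) (norm_apply_of_isometry hiso.2.2.2) hψ hφ hq
  let α : Z → Ell2 (Mem TQ) := fun z => swapState Q (e m₁) ((U m).adjoint (ket z)) ψ
  let β₀ : Z → Ell2 (Mem TQ) := fun z => swapState Q' (e' m₂) ((U' m).adjoint (ket z)) φ
  have hn : ∀ z, ‖α z‖ * ‖φ‖ = ‖ψ‖ * ‖β₀ z‖ := fun z => (key z).2
  -- Tracing out the right factor must leave `α z` with weight `‖φ‖²`, so `β₀ z` is rescaled to norm
  -- `‖φ‖`. If `β₀ z = 0`, the quotient is `0` by convention, and this is harmless because then `α z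
  -- = 0` too.
  let c : Z → ℂ := fun z => (‖φ‖ / ‖β₀ z‖ : ℝ)
  have hβ0 : ∀ z, β₀ z = 0 → α z = 0 := fun z hz => by
    have := hn z
    rw [hz, norm_zero, mul_zero] at this
    simpa [hφ] using this
  have e1 : ∀ z, (‖c z • β₀ z‖ : ℂ) • α z = (‖φ‖ : ℂ) • α z := by
    intro z
    by_cases hz : β₀ z = 0
    · simp [hβ0 z hz]
    · have : ‖β₀ z‖ ≠ 0 := norm_ne_zero_iff.2 hz
      rw [norm_smul, Complex.norm_real, norm_div, norm_norm, norm_norm, div_mul_cancel₀ _ this]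
  have e2 : ∀ z, (‖α z‖ : ℂ) • c z • β₀ z = (‖ψ‖ : ℂ) • β₀ z := by
    intro z
    by_cases hz : β₀ z = 0
    · simp [hz]
    · have : ‖β₀ z‖ ≠ 0 := norm_ne_zero_iff.2 hz
      rw [smul_smul, ← Complex.ofReal_mul, ← mul_div_assoc, hn, mul_div_assoc, div_self this,
        mul_one]
  refine ⟨α, fun z => c z • β₀ z, ?_, ?_, ?_, fun z => ?_⟩
  · have h1 : ∀ z, ‖pairVec (α z) (c z • β₀ z)‖ ^ 2 = ‖α z‖ ^ 2 * ‖φ‖ ^ 2 := by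
      intro z
      have : ‖c z • β₀ z‖ * ‖α z‖ = ‖φ‖ * ‖α z‖ := by
        simpa only [norm_smul (_ : ℂ) (α z), Complex.norm_real, norm_norm] using
          congrArg norm (e1 z)
      rw [norm_pairVec, mul_comm, this]
      ring
    simp only [h1]
    rw [norm_pairVec, mul_pow]
    exact (hasSum_norm_sq_swapState Q (he m₁) hU ψ).mul_right _
  · simp only [e1]
    have := hasSum_initOp_proj Q (e m₁) hU ((‖φ‖ : ℂ) • ψ)
    simpa only [map_smul] using this
  · simp only [e2]
    have := hasSum_initOp_proj Q' (e' m₂) hU' ((‖ψ‖ : ℂ) • φ)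
    simpa only [map_smul] using this
  · rw [pairVec_smul_right]
    refine ClosedSubmodule.toSubmodule _ |>.smul_mem _ ?_
    refine ⟨⟨⟨?_, (key z).1⟩, ?_⟩, ?_⟩
    · have hB1 := hB.mono_right Set.subset_union_left
      have hB2 := hB.mono_right Set.subset_union_right
      have h1 : pairVec (α z) φ ∈ B m := by
        rw [pairVec_swapState_left]
        exact liftOp_mem_of_disjoint_fv Q Side.one hB1 m _ hBm
      change pairVec (α z) (β₀ z) ∈ B m
      rw [pairVec_swapState_right]
      exact liftOp_mem_of_disjoint_fv Q' Side.two hB2 m _ h1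
    · change pairVec (α z) (β₀ z) ∈ spanAt Q Side.one e m
      rw [pairVec_swapState_left]
      exact swapState_mem_tensTop (T := Idx TQ) (at' Q Side.one) _ _ _
    · change pairVec (α z) (β₀ z) ∈ spanAt Q' Side.two e' m
      rw [pairVec_swapState_right]
      exact swapState_mem_tensTop (T := Idx TQ) (at' Q' Side.two) _ _ _

theorem rhl_init_quantEq {κ ι κ' ι' W Z : Type*} [Finite ι] [Finite ι']
    [∀ q, Nonempty (TQ q)] (R : κ ↪ QV) (Q : ι ↪ QV)
    (R' : κ' ↪ QV) (Q' : ι' ↪ QV) (hRQ : ∀ i j, R i ≠ Q j) (hRQ' : ∀ i j, R' i ≠ Q' j)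
    {e : Mem TC → Ell2 (Vals TQ Q)} (he : ∀ m, ‖e m‖ = 1)
    {e' : Mem TC → Ell2 (Vals TQ Q')} (he' : ∀ m, ‖e' m‖ = 1)
    {B : QPred TC TQ} (hB : Disjoint (fv B) (varsOf Q Side.one ∪ varsOf Q' Side.two))
    (V : Mem (Idx TC) → Ell2 (Vals TQ R) →L[ℂ] Ell2 W)
    (U : Mem (Idx TC) → Ell2 (Vals TQ Q) →L[ℂ] Ell2 Z)
    (V' : Mem (Idx TC) → Ell2 (Vals TQ R') →L[ℂ] Ell2 W)
    (U' : Mem (Idx TC) → Ell2 (Vals TQ Q') →L[ℂ] Ell2 Z) :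
    Rhl
      (B ⊓ quantEq (append R Q hRQ) (append R' Q' hRQ')
            (fun m => tensAppend R Q hRQ (V m) (U m))
            (fun m => tensAppend R' Q' hRQ' (V' m) (U' m))
        ⊓ Cl fun m => Isometry (U m) ∧ Isometry (U' m) ∧ Isometry (V m) ∧ Isometry (V' m))
      (initDenot Q e) (initDenot Q' e')
      (B ⊓ quantEq R R' V V' ⊓ spanAt Q Side.one e ⊓ spanAt Q' Side.two e') := by
  intro ρ hρ hsep hsat
  obtain ⟨m₁, m₂, ψ, φ, hmix⟩ := hsep.exists_isMix hρ
  choose α β hs h1 h2 hpost using fun i =>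
    exists_init_coupling R Q R' Q' hRQ hRQ' he he' hB V U V' U' (m₁ i) (m₂ i) (ψ i) (φ i)
      (hmix.mem_of_satisfies hsat i)
  let n₁ : _ × Z → Mem TC := fun p => m₁ p.1
  let n₂ : _ × Z → Mem TC := fun p => m₂ p.1
  let α' : _ × Z → Ell2 (Mem TQ) := fun p => α p.1 p.2
  let β' : _ × Z → Ell2 (Mem TQ) := fun p => β p.1 p.2
  have hsum : Summable fun p => ‖pairVec (α' p) (β' p)‖ ^ 2 :=
    summable_prod_of_hasSum (g := fun i z => ‖pairVec (α i z) (β i z)‖ ^ 2)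
      (fun _ _ => by positivity) hs hmix.1
  obtain ⟨ρ', hρ'⟩ := exists_isMix (fun p => pairC (n₁ p) (n₂ p)) hsum
  have hl := hρ'.tr2
  have hr := hρ'.tr1
  have hl' := hmix.tr2.initDenot Q e (ξ := fun i z => (‖β i z‖ : ℂ) • α i z) h1 hl.1
  have hr' := hmix.tr1.initDenot Q' e' (ξ := fun i z => (‖α i z‖ : ℂ) • β i z) h2 hr.1
  -- The marginals of the coupling and the outputs of the programs are mixtures of the same vectors,
  -- hence equal.
  exact ⟨ρ', hρ'.isCQ, hρ'.separable, hρ'.satisfies fun p => hpost p.1 p.2, hl.unique hl',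
    hr.unique hr'⟩

/-! ## Quantum equality without operators -/

theorem adjoint_reindex {X Y : Type*} (f : X ≃ Y) :
    (reindex f : Ell2 X →L[ℂ] Ell2 Y).adjoint = (reindex f.symm : Ell2 Y →L[ℂ] Ell2 X) :=
  LinearIsometryEquiv.adjoint_eq_symm _

/-- A quantum equality sees its operators only through `V*U` and its adjoint `U*V`; the target space
may change. -/
theorem quantEq_congr {ι κ Z Z' : Type*} (Q : ι ↪ QV) (R : κ ↪ QV)
    {U : Mem (Idx TC) → Ell2 (Vals TQ Q) →L[ℂ] Ell2 Z}
    {V : Mem (Idx TC) → Ell2 (Vals TQ R) →L[ℂ] Ell2 Z}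
    {U' : Mem (Idx TC) → Ell2 (Vals TQ Q) →L[ℂ] Ell2 Z'}
    {V' : Mem (Idx TC) → Ell2 (Vals TQ R) →L[ℂ] Ell2 Z'}
    (h : ∀ m, (V m).adjoint ∘L U m = (V' m).adjoint ∘L U' m) :
    quantEq Q R U V = quantEq Q R U' V' := by
  funext m
  have h' := congrArg ContinuousLinearMap.adjoint (h m)
  simp only [ContinuousLinearMap.adjoint_comp, ContinuousLinearMap.adjoint_adjoint] at h'
  rw [quantEq, quantEq, h, h']

/-- Relabelling the concatenated list at once or its two parts separately gives the same `V*U`,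
although the target spaces differ. -/
theorem quantEqId_append_eq {κ ι : Type*} (R R' : κ ↪ QV) (Q Q' : ι ↪ QV)
    (hRQ : ∀ i j, R i ≠ Q j) (hRQ' : ∀ i j, R' i ≠ Q' j)
    (hR : ∀ i, TQ (R i) = TQ (R' i)) (hQ : ∀ i, TQ (Q i) = TQ (Q' i)) :
    (quantEqId (append R Q hRQ) (append R' Q' hRQ') (append_types hR hQ hRQ hRQ') :
        QPred TC TQ) =
      quantEq (append R Q hRQ) (append R' Q' hRQ')
        (fun _ => tensAppend R Q hRQ
          (reindex (Equiv.piCongrRight fun i => Equiv.cast (hR i)) :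
            Ell2 (Vals TQ R) →L[ℂ] Ell2 (Vals TQ R'))
          (reindex (Equiv.piCongrRight fun i => Equiv.cast (hQ i)) :
            Ell2 (Vals TQ Q) →L[ℂ] Ell2 (Vals TQ Q')))
        (fun _ => tensAppend R' Q' hRQ' (.id ℂ (Ell2 (Vals TQ R')))
          (.id ℂ (Ell2 (Vals TQ Q')))) := by

  refine quantEq_congr _ _ fun _ => ?_
  have e1 : tensAppend R' Q' hRQ' (.id ℂ (Ell2 (Vals TQ R'))) (.id ℂ (Ell2 (Vals TQ Q')))
      = (reindex (valsAppend TQ R' Q' hRQ') :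
        Ell2 (Vals TQ (append R' Q' hRQ')) →L[ℂ] Ell2 (Vals TQ R' × Vals TQ Q')) := rfl
  rw [e1, adjoint_reindex, ContinuousLinearMap.adjoint_id]
  ext u x
  refine congrArg (fun y => u y) (funext fun i => ?_)
  rcases i with i | i <;> rfl

theorem rhl_init_quantEqId {κ ι : Type*} [Finite ι] [∀ q, Nonempty (TQ q)]
    (R : κ ↪ QV) (Q : ι ↪ QV) (R' : κ ↪ QV) (Q' : ι ↪ QV)
    (hRQ : ∀ i j, R i ≠ Q j) (hRQ' : ∀ i j, R' i ≠ Q' j)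
    (hR : ∀ i, TQ (R i) = TQ (R' i)) (hQ : ∀ i, TQ (Q i) = TQ (Q' i))
    {e : Mem TC → Ell2 (Vals TQ Q)} (he : ∀ m, ‖e m‖ = 1)
    {e' : Mem TC → Ell2 (Vals TQ Q')} (he' : ∀ m, ‖e' m‖ = 1)
    {B : QPred TC TQ} (hB : Disjoint (fv B) (varsOf Q Side.one ∪ varsOf Q' Side.two)) :
    Rhl
      (B ⊓ quantEqId (append R Q hRQ) (append R' Q' hRQ') (append_types hR hQ hRQ hRQ'))
      (initDenot Q e) (initDenot Q' e') (B ⊓ quantEqId R R' hR) := by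
  intro ρ hρ hsep hsat
  obtain ⟨ρ', h1, h2, h3, h4⟩ := rhl_init_quantEq R Q R' Q' hRQ hRQ' he he' hB
    (fun _ => (reindex (Equiv.piCongrRight fun i => Equiv.cast (hR i)) :
      Ell2 (Vals TQ R) →L[ℂ] Ell2 (Vals TQ R')))
    (fun _ => (reindex (Equiv.piCongrRight fun i => Equiv.cast (hQ i)) :
      Ell2 (Vals TQ Q) →L[ℂ] Ell2 (Vals TQ Q')))
    (fun _ => .id ℂ (Ell2 (Vals TQ R'))) (fun _ => .id ℂ (Ell2 (Vals TQ Q'))) ρ hρ hsep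
    (fun m => by
      have hm := hsat m
      rw [quantEqId_append_eq R R' Q Q' hRQ hRQ' hR hQ] at hm
      refine le_inf hm ?_
      -- Relabellings and identities are isometries, so the classical condition is the whole space.
      rw [Cl, if_pos ⟨LinearIsometryEquiv.isometry _, isometry_id, LinearIsometryEquiv.isometry _,
        isometry_id⟩]
      exact le_top)
  exact ⟨ρ', h1, h2, fun m => (h3 m).trans (inf_le_left.trans inf_le_left), h4⟩

end Judgments

end

theorem mainTheorem2 {CV QV : Type*} {TC : CV → Type*} {TQ : QV → Type*}
    [∀ x, Nonempty (TC x)] [∀ q, Nonempty (TQ q)] :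
    (∀ {k n k' n' : ℕ}
      (R : Fin k ↪ QV) (Q : Fin n ↪ QV) (R' : Fin k' ↪ QV) (Q' : Fin n' ↪ QV)
      (hRQ : ∀ i j, R i ≠ Q j) (hRQ' : ∀ i j, R' i ≠ Q' j)
      (e : Mem TC → Ell2 (Vals TQ Q)) (_ : ∀ m, ‖e m‖ = 1)
      (e' : Mem TC → Ell2 (Vals TQ Q')) (_ : ∀ m, ‖e' m‖ = 1)
      (B : QPred TC TQ)
      (_ : Disjoint (fv B) (varsOf Q Side.one ∪ varsOf Q' Side.two))
      (W Z : Type*)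
      (V : Mem (Idx TC) → Ell2 (Vals TQ R) →L[ℂ] Ell2 W)
      (U : Mem (Idx TC) → Ell2 (Vals TQ Q) →L[ℂ] Ell2 Z)
      (V' : Mem (Idx TC) → Ell2 (Vals TQ R') →L[ℂ] Ell2 W)
      (U' : Mem (Idx TC) → Ell2 (Vals TQ Q') →L[ℂ] Ell2 Z),
      Rhl
        (B ⊓ quantEq (append R Q hRQ) (append R' Q' hRQ')
              (fun m => tensAppend R Q hRQ (V m) (U m))
              (fun m => tensAppend R' Q' hRQ' (V' m) (U' m))
          ⊓ Cl fun m => Isometry (U m) ∧ Isometry (U' m) ∧ Isometry (V m) ∧ Isometry (V' m))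
        (initDenot Q e) (initDenot Q' e')
        (B ⊓ quantEq R R' V V' ⊓ spanAt Q Side.one e ⊓ spanAt Q' Side.two e')) ∧
    (∀ {k n : ℕ}
      (R : Fin k ↪ QV) (Q : Fin n ↪ QV) (R' : Fin k ↪ QV) (Q' : Fin n ↪ QV)
      (hRQ : ∀ i j, R i ≠ Q j) (hRQ' : ∀ i j, R' i ≠ Q' j)
      (hR : ∀ i, TQ (R i) = TQ (R' i)) (hQ : ∀ i, TQ (Q i) = TQ (Q' i))
      (e : Mem TC → Ell2 (Vals TQ Q)) (_ : ∀ m, ‖e m‖ = 1)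
      (e' : Mem TC → Ell2 (Vals TQ Q')) (_ : ∀ m, ‖e' m‖ = 1)
      (B : QPred TC TQ)
      (_ : Disjoint (fv B) (varsOf Q Side.one ∪ varsOf Q' Side.two)),
      Rhl
        (B ⊓ quantEqId (append R Q hRQ) (append R' Q' hRQ') (append_types hR hQ hRQ hRQ'))
        (initDenot Q e) (initDenot Q' e')
        (B ⊓ quantEqId R R' hR)) := ⟨fun R Q R' Q' hRQ hRQ' _ he _ he' _ hB _ _ V U V' U' =>
      rhl_init_quantEq R Q R' Q' hRQ hRQ' he he' hB V U V' U',
    fun R Q R' Q' hRQ hRQ' hR hQ _ he _ he' _ hB =>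
      rhl_init_quantEqId R Q R' Q' hRQ hRQ' hR hQ he he' hB⟩
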